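/- **Setting.** Let $\nu$ be a measure on a measurable space $\mathcal Z$, let $\Theta\subset\mathbb R$ be compact, $\theta_0\in\operatorname{int}\Theta$, and let $f(\cdot,\theta)>0$, $\theta\in\Theta$, be probability densities with respect to $\nu$. Let $Z_1,Z_2,\dots$ be i.i.d. with density $f(\cdot,\theta_0)$, and write $E$ for expectation under this law. Assume: 1. for each $z$, $\theta\mapsto\log f(z,\theta)$ is $7$ times continuously differentiable on $\Theta$, and for each $\theta\in\Theta$ and $m\le 7$ the derivative $\partial^m\log f(z,\theta)/\partial\theta^m$ is a measurable function of $z$ (up to $P_{\theta_0}$-null sets); 2. there is a function $M$ with $|\partial^m\log f(z,\theta)/\partial\theta^m|\le M(z)$ for all $z$, $\theta\in\Theta$, $0\le m\le 7$, and $E[M(Z_i)^Q]<\infty$ for some $Q>16$; 3. if $\theta\in\Theta$, $\theta\ne\theta_0$, then it is not the case that $f(Z_i,\theta)=f(Z_i,\theta_0)$ almost surely; 4. $\mathcal I:=-E[\ell^\theta(Z_i,\theta_0)]>0$, and $\int f(z,\theta)\,d\nu(z)=1$ may be differentiated twice under the integral sign at $\theta_0$, i.e. $\int\partial_\theta^2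 f(z,\theta_0)\,d\nu(z)=0$ (equivalently, the information equality $E[\ell(Z_i,\theta_0)^2]=\mathcal I$ holds). Here $\ell=\partial_\theta\log f$, $\ell^{\theta}=\partial^2_\theta\log f$, $\ell^{\theta\theta}=\partial^3_\theta\log f$, $\ell^{\theta\theta\theta}=\partial^4_\theta\log f$. When the argument is omitted, functions are evaluated at $(Z_i,\theta_0)$. Put $\mathcal Q_1=E[\ell^{\theta\theta}]$, $\mathcal Q_2=E[\ell^{\theta\theta\theta}]$, $U_i=\ell$, $V_i=\ell^\theta-E[\ell^\theta]$, $W_i=\ell^{\theta\theta}-E[\ell^{\theta\theta}]$, $U=n^{-1/2}\sum_{i=1}^n U_i$, and similarly $V$, $W$. Let $$A_1=\mathcal I^{-1}U,\qquad A_2=\tfrac12\mathcal I^{-3}\mathcal Q_1U^2+\mathcal I^{-2}UV,$$ $$A_3=\tfrac16\mathcal I^{-4}\mathcal Q_2U^3+\tfrac12\mathcal I^{-5}\mathcal Q_1^2U^3+\tfrac32\mathcal I^{-4}\mathcal Q_1U^2V+\tfrac12\mathcal I^{-3}U^2W+\mathcal I^{-3}UV^2,$$ $$b(\theta_0)=\frac{1}{2\mathcal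 I^3}E[\ell^{\theta\theta}]E[\ell^2]+\frac1{\mathcal I^2}E[\ell\ell^\theta],$$ and $\mathbb B=n^{-1/2}\sum_{i=1}^n\mathbb B_i$ with $$\begin{aligned}\mathbb B_i={}&\Big(\tfrac12\mathcal I^{-3}\mathcal Q_2+\tfrac32\mathcal I^{-4}\mathcal Q_1^2+3\mathcal I^{-4}\mathcal Q_1E[U_iV_i]+\mathcal I^{-3}\big(E[U_iW_i]+E[(\ell^\theta)^2]\big)\Big)U_i\\&+\Big(\tfrac32\mathcal I^{-3}\mathcal Q_1+2\mathcal I^{-3}E[U_iV_i]\Big)V_i+\tfrac12\mathcal I^{-2}W_i\\&+\tfrac12\mathcal I^{-3}\mathcal Q_1\big(\ell^2-E[\ell^2]\big)+\mathcal I^{-2}\big(\ell\ell^\theta-E[\ell\ell^\theta]\big).\end{aligned}$$ Let $\hat\theta$ be any maximizer over $\Theta$ of $n^{-1}\sum_{i=1}^n\log f(Z_i,\theta)$, and let $\tilde\theta_a=\hat\theta-\tilde b(\hat\theta)/n$, where $$\tilde b(\theta)=-\frac{\big(\frac1n\sum_i\ell^{\theta\theta}(Z_i,\theta)\big)\big(\frac1n\sum_i\ell(Z_i,\theta)^2\big)}{2\big(\frac1n\sum_i\ell^\theta(Z_i,\theta)\big)^3}+\frac{\frac1n\sum_i\ell(Z_i,\theta)\ell^\theta(Z_i,\theta)}{\big(\frac1n\sum_i\ell^\theta(Z_i,\theta)\big)^2}$$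 is the sample-average analytical bias estimate (which does not impose the information equality). **Proposition.** As $n\to\infty$, the bias estimate has influence function $\mathbb B_i$, $$\sqrt n\,\big(\tilde b(\hat\theta)-b(\theta_0)\big)=\mathbb B+o_p(1),$$ and the bias-corrected MLE has the third-order expansion $$\sqrt n\,(\tilde\theta_a-\theta_0)=A_1+\frac1{\sqrt n}\big(A_2-b(\theta_0)\big)+\frac1n\big(A_3-\mathbb B\big)+o_p(n^{-1}).$$ -/

import Mathlib

open MeasureTheory ProbabilityTheory Filter Topology

noncomputable section

namespace BiasMLE

variable {𝒵 : Type*} [MeasurableSpace 𝒵]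

/-- `∂^m log f(z, θ) / ∂θ^m`, for `θ` in the parameter space `Θ` (one-sided at end points). -/
def logDeriv (f : 𝒵 → ℝ → ℝ) (Θ : Set ℝ) (m : ℕ) (z : 𝒵) (θ : ℝ) : ℝ :=
  iteratedDerivWithin m (fun t => Real.log (f z t)) Θ θ

/-- The distribution with density `f(·, θ)` with respect to `ν`. -/
def law (ν : Measure 𝒵) (f : 𝒵 → ℝ → ℝ) (θ : ℝ) : Measure 𝒵 :=
  ν.withDensity (fun z => ENNReal.ofReal (f z θ))

/-- `f(·, θ)`, `θ ∈ Θ`, is a family of positive probability densities with respect to `ν`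
satisfying the smoothness, moment, identification and measurability conditions at `θ₀`. -/
structure RegularModel (ν : Measure 𝒵) (f : 𝒵 → ℝ → ℝ) (Θ : Set ℝ) (θ₀ : ℝ) : Prop where
  pos : ∀ z, ∀ θ ∈ Θ, 0 < f z θ
  measurable_density : ∀ θ ∈ Θ, Measurable fun z => f z θ
  lintegral_density : ∀ θ ∈ Θ, ∫⁻ z, ENNReal.ofReal (f z θ) ∂ν = 1
  smooth : ∀ z, ContDiffOn ℝ 7 (fun θ => Real.log (f z θ)) Θ
  compact : IsCompact Θ
  interior : θ₀ ∈ interior Θ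
  envelope : ∃ M : 𝒵 → ℝ, (∀ z, ∀ θ ∈ Θ, ∀ m ≤ 7, |logDeriv f Θ m z θ| ≤ M z) ∧
    ∃ Q : ℝ, 16 < Q ∧ Integrable (fun z => M z ^ Q) (law ν f θ₀)
  identified : ∀ θ ∈ Θ, θ ≠ θ₀ → ¬ (∀ᵐ z ∂(law ν f θ₀), f z θ = f z θ₀)
  measurable_deriv : ∀ θ ∈ Θ, ∀ m ≤ 7, AEMeasurable (fun z => logDeriv f Θ m z θ) (law ν f θ₀)

section Population

variable (ν : Measure 𝒵) (f : 𝒵 → ℝ → ℝ) (Θ : Set ℝ) (θ₀ : ℝ)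

/-- Expectation of `g(Zᵢ)` when `Zᵢ` has density `f(·, θ₀)`. -/
def E (g : 𝒵 → ℝ) : ℝ := ∫ z, g z ∂(law ν f θ₀)

/-- The score `ℓ(z, θ)`. -/
def ell (z : 𝒵) (θ : ℝ) : ℝ := logDeriv f Θ 1 z θ
/-- `ℓ^θ(z, θ)`. -/
def ell1 (z : 𝒵) (θ : ℝ) : ℝ := logDeriv f Θ 2 z θ
/-- `ℓ^{θθ}(z, θ)`. -/
def ell2 (z : 𝒵) (θ : ℝ) : ℝ := logDeriv f Θ 3 z θ
/-- `ℓ^{θθθ}(z, θ)`. -/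
def ell3 (z : 𝒵) (θ : ℝ) : ℝ := logDeriv f Θ 4 z θ

/-- `𝓘 = -E[ℓ^θ]`. -/
def info : ℝ := - E ν f θ₀ (fun z => ell1 f Θ z θ₀)
/-- `𝒬₁ = E[ℓ^{θθ}]`. -/
def Q1 : ℝ := E ν f θ₀ (fun z => ell2 f Θ z θ₀)
/-- `𝒬₂ = E[ℓ^{θθθ}]`. -/
def Q2 : ℝ := E ν f θ₀ (fun z => ell3 f Θ z θ₀)

/-- `Uᵢ` at `θ₀`, as a function of the observation. -/
def Ui (z : 𝒵) : ℝ := ell f Θ z θ₀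
/-- `Vᵢ` at `θ₀`. -/
def Vi (z : 𝒵) : ℝ := ell1 f Θ z θ₀ - E ν f θ₀ (fun y => ell1 f Θ y θ₀)
/-- `Wᵢ` at `θ₀`. -/
def Wi (z : 𝒵) : ℝ := ell2 f Θ z θ₀ - E ν f θ₀ (fun y => ell2 f Θ y θ₀)

/-- The higher-order bias `b(θ₀)`. -/
def bias : ℝ :=
  1 / (2 * info ν f Θ θ₀ ^ 3) * E ν f θ₀ (fun z => ell2 f Θ z θ₀)
      * E ν f θ₀ (fun z => ell f Θ z θ₀ ^ 2)
    + 1 / info ν f Θ θ₀ ^ 2 * E ν f θ₀ (fun z => ell f Θ z θ₀ * ell1 f Θ z θ₀)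

/-- The influence function `𝔹ᵢ`, as a function of the observation. -/
def BBi (z : 𝒵) : ℝ :=
  let I := info ν f Θ θ₀
  let q₁ := Q1 ν f Θ θ₀
  let q₂ := Q2 ν f Θ θ₀
  let EUV := E ν f θ₀ (fun y => Ui f Θ θ₀ y * Vi ν f Θ θ₀ y)
  let EUW := E ν f θ₀ (fun y => Ui f Θ θ₀ y * Wi ν f Θ θ₀ y)
  (1 / 2 * (I ^ 3)⁻¹ * q₂ + 3 / 2 * (I ^ 4)⁻¹ * q₁ ^ 2 + 3 * (I ^ 4)⁻¹ * q₁ * EUV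
      + (I ^ 3)⁻¹ * (EUW + E ν f θ₀ (fun y => ell1 f Θ y θ₀ ^ 2))) * Ui f Θ θ₀ z
    + (3 / 2 * (I ^ 3)⁻¹ * q₁ + 2 * (I ^ 3)⁻¹ * EUV) * Vi ν f Θ θ₀ z
    + 1 / 2 * (I ^ 2)⁻¹ * Wi ν f Θ θ₀ z
    + 1 / 2 * (I ^ 3)⁻¹ * q₁
        * (ell f Θ z θ₀ ^ 2 - E ν f θ₀ (fun y => ell f Θ y θ₀ ^ 2))
    + (I ^ 2)⁻¹ * (ell f Θ z θ₀ * ell1 f Θ z θ₀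
        - E ν f θ₀ (fun y => ell f Θ y θ₀ * ell1 f Θ y θ₀))

end Population

section Sample

/-! The sample of size `n` is `Z 0, …, Z (n - 1)`, an initial segment of a sequence `Z`. -/

variable (ν : Measure 𝒵) (f : 𝒵 → ℝ → ℝ) (Θ : Set ℝ) (θ₀ : ℝ)

/-- `n^{-1/2} ∑ᵢ g(Zᵢ)`. -/
def normSum (g : 𝒵 → ℝ) (n : ℕ) (Z : ℕ → 𝒵) : ℝ :=
  (∑ i ∈ Finset.range n, g (Z i)) / Real.sqrt n

/-- `n^{-1} ∑ᵢ g(Zᵢ)`. -/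
def sampleMean (g : 𝒵 → ℝ) (n : ℕ) (Z : ℕ → 𝒵) : ℝ :=
  (∑ i ∈ Finset.range n, g (Z i)) / n

/-- `t` maximizes the average log-likelihood of the sample over `Θ`. -/
def IsMLE (n : ℕ) (Z : ℕ → 𝒵) (t : ℝ) : Prop :=
  t ∈ Θ ∧ IsMaxOn (fun θ => sampleMean (fun z => Real.log (f z θ)) n Z) Θ t

/-- `U(θ₀)`. -/
def U (n : ℕ) (Z : ℕ → 𝒵) : ℝ := normSum (Ui f Θ θ₀) n Z
/-- `V(θ₀)`. -/
def V (n : ℕ) (Z : ℕ → 𝒵) : ℝ := normSum (Vi ν f Θ θ₀) n Z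
/-- `W(θ₀)`. -/
def W (n : ℕ) (Z : ℕ → 𝒵) : ℝ := normSum (Wi ν f Θ θ₀) n Z
/-- `𝔹`. -/
def BB (n : ℕ) (Z : ℕ → 𝒵) : ℝ := normSum (BBi ν f Θ θ₀) n Z

/-- First-order term of the expansion of the MLE. -/
def A1 (n : ℕ) (Z : ℕ → 𝒵) : ℝ := (info ν f Θ θ₀)⁻¹ * U f Θ θ₀ n Z

/-- Second-order term. -/
def A2 (n : ℕ) (Z : ℕ → 𝒵) : ℝ :=
  let I := info ν f Θ θ₀
  1 / 2 * (I ^ 3)⁻¹ * Q1 ν f Θ θ₀ * U f Θ θ₀ n Z ^ 2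
    + (I ^ 2)⁻¹ * U f Θ θ₀ n Z * V ν f Θ θ₀ n Z

/-- Third-order term. -/
def A3 (n : ℕ) (Z : ℕ → 𝒵) : ℝ :=
  let I := info ν f Θ θ₀
  let q₁ := Q1 ν f Θ θ₀
  let q₂ := Q2 ν f Θ θ₀
  let u := U f Θ θ₀ n Z
  let v := V ν f Θ θ₀ n Z
  let w := W ν f Θ θ₀ n Z
  1 / 6 * (I ^ 4)⁻¹ * q₂ * u ^ 3 + 1 / 2 * (I ^ 5)⁻¹ * q₁ ^ 2 * u ^ 3
    + 3 / 2 * (I ^ 4)⁻¹ * q₁ * u ^ 2 * v + 1 / 2 * (I ^ 3)⁻¹ * u ^ 2 * w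
    + (I ^ 3)⁻¹ * u * v ^ 2

/-- The sample-average bias estimate `b̃(θ)`, which does not impose the information equality. -/
def biasEst (n : ℕ) (Z : ℕ → 𝒵) (θ : ℝ) : ℝ :=
  - (sampleMean (fun z => ell2 f Θ z θ) n Z * sampleMean (fun z => ell f Θ z θ ^ 2) n Z)
      / (2 * sampleMean (fun z => ell1 f Θ z θ) n Z ^ 3)
    + sampleMean (fun z => ell f Θ z θ * ell1 f Θ z θ) n Z
      / sampleMean (fun z => ell1 f Θ z θ) n Z ^ 2

/-- The analytical bias-corrected MLE `θ̃ₐ`, where `t` is the MLE. -/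
def correctedMLE (n : ℕ) (Z : ℕ → 𝒵) (t : ℝ) : ℝ := t - biasEst f Θ n Z t / n

end Sample

/-- `Xₙ = o_p(rₙ)`. -/
def IsLittleOp {Ω : Type*} [MeasurableSpace Ω] (P : Measure Ω) (X : ℕ → Ω → ℝ) (r : ℕ → ℝ) :
    Prop :=
  TendstoInMeasure P (fun n ω => X n ω / r n) atTop (fun _ => 0)

end BiasMLE

end

/-!
The maximum likelihood estimator is a root of the sample score, whose Taylor expansion at `θ₀` has
coefficients that are known up to `n^{-1/2}` times normalized sums with bounded second moments.
Solving this cubic equation by substitution gives the expansion of the estimator, and inserting the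
first-order part of that expansion into the sample averages in the bias estimate gives, by the delta
method, the influence function of the latter. The bias-corrected estimator subtracts the two.

* Convergence in probability is convergence along a filter `whp` on pairs `(n, ω)`. It is built from
  outer measure, so that no measurability of the maximizer is needed. `X = O_p(1)` (`BddInProb`)
  means that `c X` tends to zero along `whp` for every null sequence `c`; this class is closed under
  sums and products, and contains the normalized sums by independence
  (`IsIIDSample.bddInProb_normSum`).
* Consistency (`RegularModel.tendsto_mle`) is Wald's argument. The uniform law of large numbers is
  the strong law in the separable Banach space `C(Θ, ℝ)`, and the Kullback-Leibler inequality
  (`RegularModel.integral_log_lt`) separates `θ₀` from the rest of `Θ`. The same inequality makes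
  `θ₀` an interior maximizer of the expected log-likelihood, whence the score has mean zero.
* `RegularModel.bddInProb_sqrt_mul_mle_sub` is root-`n` consistency. With it the Taylor remainder of
  the score is of fourth order, and `score_equation_expansion` turns the score equation into
  `RegularModel.mle_expansion`, with an error `O_p(n^{-3/2})`.
* `HasExpansion` records expansions `a₀ + n^{-1/2} a₁ + O_p(n⁻¹)`. They are stable under the
  algebraic operations in the bias estimate, which yields `RegularModel.hasExpansion_biasEst`.
-/

namespace BiasMLE

/-! ### Stochastic order symbols -/

section StochasticOrder

variable {Ω : Type*} [MeasurableSpace Ω] {P : Measure Ω}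

/-- The filter of the events that hold with probability tending to one: a set `S` of pairs
`(n, ω)` belongs to it if the `n`-th section of its complement has (outer) probability tending to
zero. Convergence in probability is convergence along this filter. No measurability is involved, so
that non-measurable maximizers of the likelihood are allowed. -/
def whp (P : Measure Ω) : Filter (ℕ × Ω) where
  sets := {S | Tendsto (fun n => P {ω | (n, ω) ∉ S}) atTop (𝓝 0)}
  univ_sets := by simp
  sets_of_superset := fun {S T} hS hST =>
    tendsto_of_tendsto_of_tendsto_of_le_of_le tendsto_const_nhds hS (fun _ => zero_le)
      fun n => measure_mono fun ω hω h => hω (hST h)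
  inter_sets := fun {S T} hS hT => by
    have h := Tendsto.add hS hT
    rw [add_zero] at h
    refine tendsto_of_tendsto_of_tendsto_of_le_of_le tendsto_const_nhds h (fun _ => zero_le)
      fun n => (measure_mono ?_).trans (measure_union_le _ _)
    intro ω hω
    by_contra hc
    simp only [Set.mem_union, Set.mem_ofPred_eq, not_or, not_not] at hc
    exact hω hc

theorem eventually_whp {p : ℕ × Ω → Prop} :
    (∀ᶠ x in whp P, p x) ↔ Tendsto (fun n => P {ω | ¬ p (n, ω)}) atTop (𝓝 0) :=
  Iff.rfl

theorem tendsto_fst_whp : Tendsto Prod.fst (whp P) atTop := by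
  rw [tendsto_atTop]
  intro N
  rw [eventually_whp]
  refine tendsto_const_nhds.congr' ?_
  filter_upwards [eventually_ge_atTop N] with n hn
  simp [hn]

theorem tendsto_whp_iff_tendstoInMeasure {X : ℕ → Ω → ℝ} {a : ℝ} :
    Tendsto (fun p : ℕ × Ω => X p.1 p.2) (whp P) (𝓝 a) ↔
      TendstoInMeasure P X atTop (fun _ => a) := by
  rw [EMetric.tendsto_nhds, TendstoInMeasure]
  simp only [eventually_whp, not_lt, gt_iff_lt]

theorem isLittleOp_iff {X : ℕ → Ω → ℝ} {r : ℕ → ℝ} :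
    IsLittleOp P X r ↔ Tendsto (fun p : ℕ × Ω => X p.1 p.2 / r p.1) (whp P) (𝓝 0) :=
  (tendsto_whp_iff_tendstoInMeasure (X := fun n ω => X n ω / r n)).symm

/-- `X = O_p(1)`: every deterministic null sequence `c` makes `c X` tend to zero in probability. -/
def BddInProb (P : Measure Ω) (X : ℕ × Ω → ℝ) : Prop :=
  ∀ c : ℕ → ℝ, Tendsto c atTop (𝓝 0) → Tendsto (fun p => c p.1 * X p) (whp P) (𝓝 0)

namespace BddInProb

variable {X Y : ℕ × Ω → ℝ}

theorem of_tendsto {a : ℝ} (h : Tendsto X (whp P) (𝓝 a)) : BddInProb P X := fun c hc => by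
  simpa using (hc.comp tendsto_fst_whp).mul h

theorem const (a : ℝ) : BddInProb P fun _ => a := of_tendsto tendsto_const_nhds

theorem add (hX : BddInProb P X) (hY : BddInProb P Y) : BddInProb P fun p => X p + Y p :=
  fun c hc => by simpa [mul_add] using (hX c hc).add (hY c hc)

theorem neg (hX : BddInProb P X) : BddInProb P fun p => -X p :=
  fun c hc => by simpa using (hX c hc).neg

theorem sub (hX : BddInProb P X) (hY : BddInProb P Y) : BddInProb P fun p => X p - Y p := by
  simpa [sub_eq_add_neg] using hX.add hY.neg

/-- The null sequence `c` is split into `√|c|` and `c / √|c|`, which are both null sequences. -/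
theorem mul (hX : BddInProb P X) (hY : BddInProb P Y) : BddInProb P fun p => X p * Y p := by
  intro c hc
  have h1 : Tendsto (fun n => √|c n|) atTop (𝓝 0) := by
    have h := hc.abs.sqrt
    rwa [abs_zero, Real.sqrt_zero] at h
  have h2 : Tendsto (fun n => c n / √|c n|) atTop (𝓝 0) := by
    refine squeeze_zero_norm (fun n => ?_) h1
    rw [Real.norm_eq_abs, abs_div, abs_of_nonneg (Real.sqrt_nonneg _), Real.div_sqrt]
  have h := (hX _ h1).mul (hY _ h2)
  rw [mul_zero] at h
  refine h.congr fun p => ?_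
  rcases eq_or_ne (c p.1) 0 with h0 | h0
  · simp [h0]
  · have : √|c p.1| ≠ 0 := (Real.sqrt_pos.2 (abs_pos.2 h0)).ne'
    field_simp

theorem const_mul (a : ℝ) (hX : BddInProb P X) : BddInProb P fun p => a * X p :=
  (const a).mul hX

theorem pow (hX : BddInProb P X) (k : ℕ) : BddInProb P fun p => X p ^ k := by
  induction k with
  | zero => simpa using const 1
  | succ k ih => simpa [pow_succ] using ih.mul hX

theorem mono (hY : BddInProb P Y) (h : ∀ᶠ p in whp P, |X p| ≤ |Y p|) : BddInProb P X := by
  intro c hc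
  have h' := (hY c hc).abs
  rw [abs_zero] at h'
  refine squeeze_zero_norm' ?_ h'
  filter_upwards [h] with p hp
  rw [Real.norm_eq_abs, abs_mul, abs_mul]
  gcongr

end BddInProb

/-- The rate `n^{-1/2}`, as a function of the pair `(n, ω)`. -/
noncomputable def rate (p : ℕ × Ω) : ℝ := (√(p.1 : ℝ))⁻¹

theorem tendsto_rate_nat : Tendsto (fun n : ℕ => (√(n : ℝ))⁻¹) atTop (𝓝 0) :=
  tendsto_inv_atTop_zero.comp (Real.tendsto_sqrt_atTop.comp tendsto_natCast_atTop_atTop)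

theorem tendsto_rate : Tendsto (rate (Ω := Ω)) (whp P) (𝓝 0) :=
  tendsto_rate_nat.comp tendsto_fst_whp

theorem BddInProb.rate : BddInProb P (BiasMLE.rate (Ω := Ω)) :=
  BddInProb.of_tendsto tendsto_rate

theorem BddInProb.tendsto_rate_mul {X : ℕ × Ω → ℝ} (hX : BddInProb P X) :
    Tendsto (fun p => BiasMLE.rate p * X p) (whp P) (𝓝 0) :=
  hX (fun n => (√(n : ℝ))⁻¹) tendsto_rate_nat

theorem eventually_pos_whp : ∀ᶠ p : ℕ × Ω in whp P, 0 < p.1 :=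
  tendsto_fst_whp.eventually (eventually_gt_atTop 0)

end StochasticOrder

theorem sqrt_natCast_pos {n : ℕ} (hn : 0 < n) : 0 < √(n : ℝ) :=
  Real.sqrt_pos.2 (by exact_mod_cast hn)

/-! ### Sample averages of square-integrable functions -/

/-- `Z 0, Z 1, …` are independent with common distribution `Q`. -/
structure IsIIDSample {𝒵 Ω : Type*} [MeasurableSpace 𝒵] [MeasurableSpace Ω] (P : Measure Ω)
    (Q : Measure 𝒵) (Z : ℕ → Ω → 𝒵) : Prop where
  measurable : ∀ i, Measurable (Z i)
  indep : iIndepFun Z P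
  law : ∀ i, P.map (Z i) = Q

section Sample

variable {𝒵 Ω : Type*} [MeasurableSpace 𝒵] [MeasurableSpace Ω] {P : Measure Ω}
  [IsProbabilityMeasure P] {Q : Measure 𝒵} {Z : ℕ → Ω → 𝒵}

namespace IsIIDSample

omit [IsProbabilityMeasure P] in
theorem measurePreserving (hZ : IsIIDSample P Q Z) (i : ℕ) : MeasurePreserving (Z i) P Q :=
  ⟨hZ.measurable i, hZ.law i⟩

theorem isProbabilityMeasure (hZ : IsIIDSample P Q Z) : IsProbabilityMeasure Q := by
  rw [← hZ.law 0]
  exact Measure.isProbabilityMeasure_map (hZ.measurable 0).aemeasurable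

/-- By independence the variance of `normSum g n` is that of `g`, uniformly in `n`. -/
theorem bddInProb_normSum (hZ : IsIIDSample P Q Z) {g : 𝒵 → ℝ} (hg : MemLp g 2 Q)
    (hg0 : ∫ z, g z ∂Q = 0) :
    BddInProb P fun p => normSum g p.1 fun i => Z i p.2 := by
  intro c hc
  have hL : ∀ i, MemLp (fun ω => g (Z i ω)) 2 P := fun i =>
    hg.comp_measurePreserving (hZ.measurePreserving i)
  have hae : ∀ i, AEMeasurable g (P.map (Z i)) := fun i => by
    rw [hZ.law i]; exact hg.aestronglyMeasurable.aemeasurable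
  have hmean : ∀ i, ∫ ω, g (Z i ω) ∂P = 0 := fun i => by
    rw [← integral_map (hZ.measurable i).aemeasurable (hae i).aestronglyMeasurable, hZ.law i, hg0]
  have hvar : ∀ i, variance (fun ω => g (Z i ω)) P = ∫ z, g z ^ 2 ∂Q := fun i => by
    rw [variance_of_integral_eq_zero (hL i).aestronglyMeasurable.aemeasurable (hmean i)]
    have hsq : AEStronglyMeasurable (fun z => g z ^ 2) (P.map (Z i)) :=
      ((hae i).pow_const 2).aestronglyMeasurable
    rw [← hZ.law i, integral_map (hZ.measurable i).aemeasurable hsq]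
  have hvarS : ∀ n, variance (∑ i ∈ Finset.range n, fun ω => g (Z i ω)) P
      = n * ∫ z, g z ^ 2 ∂Q := fun n => by
    rw [IndepFun.variance_sum (fun i _ => hL i)]
    · simp [hvar]
    · intro i _ j _ hij
      exact (hZ.indep.indepFun hij).comp₀ (hZ.measurable i).aemeasurable
        (hZ.measurable j).aemeasurable (hae i) (hae j)
  rw [tendsto_whp_iff_tendstoInMeasure
    (X := fun n ω => c n * normSum g n fun i => Z i ω)]
  rw [tendstoInMeasure_iff_dist]
  intro ε hε
  set T : ℕ → Ω → ℝ := fun n => (c n / √n) • ∑ i ∈ Finset.range n, fun ω => g (Z i ω) with hT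
  have hTL : ∀ n, MemLp (T n) 2 P := fun n =>
    (memLp_finsetSum' _ fun i _ => hL i).const_smul _
  have hTmean : ∀ n, ∫ ω, T n ω ∂P = 0 := fun n => by
    simp only [hT, Pi.smul_apply, Finset.sum_apply, smul_eq_mul]
    rw [integral_const_mul, integral_finsetSum _ fun i _ => (hL i).integrable one_le_two]
    simp [hmean]
  have hTvar : ∀ n, 0 < n → variance (T n) P = c n ^ 2 * ∫ z, g z ^ 2 ∂Q := fun n hn => by
    have : (n : ℝ) ≠ 0 := by positivity
    rw [hT, variance_smul, hvarS, div_pow, Real.sq_sqrt (Nat.cast_nonneg n)]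
    field_simp
  have hlim : Tendsto (fun n => ENNReal.ofReal (c n ^ 2 * (∫ z, g z ^ 2 ∂Q) / ε ^ 2)) atTop
      (𝓝 0) := by
    have h : Tendsto (fun n => c n ^ 2 * (∫ z, g z ^ 2 ∂Q) / ε ^ 2) atTop (𝓝 0) := by
      simpa using ((hc.pow 2).mul_const (∫ z, g z ^ 2 ∂Q)).div_const (ε ^ 2)
    simpa using ENNReal.tendsto_ofReal h
  refine tendsto_of_tendsto_of_tendsto_of_le_of_le' tendsto_const_nhds hlim
    (Eventually.of_forall fun _ => zero_le) ?_
  filter_upwards [eventually_gt_atTop 0] with n hn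
  have h := meas_ge_le_variance_div_sq (hTL n) hε
  rw [hTmean, hTvar n hn] at h
  refine le_trans (measure_mono fun ω hω => ?_) h
  have hω' : ε ≤ dist (c n * normSum g n fun i => Z i ω) 0 := hω
  rw [Real.dist_eq, sub_zero] at hω'
  change ε ≤ |T n ω - 0|
  have hTω : T n ω = c n * normSum g n fun i => Z i ω := by
    simp only [hT, Pi.smul_apply, Finset.sum_apply, smul_eq_mul, normSum]
    ring
  rwa [sub_zero, hTω]

end IsIIDSample

omit [MeasurableSpace 𝒵] in
theorem sampleMean_eq_add_rate_mul (g : 𝒵 → ℝ) (a : ℝ) {n : ℕ} (hn : 0 < n) (x : ℕ → 𝒵) :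
    sampleMean g n x = a + (√(n : ℝ))⁻¹ * normSum (fun z => g z - a) n x := by
  have h0 : (n : ℝ) ≠ 0 := by positivity
  have h1 : (√(n : ℝ))⁻¹ * (√(n : ℝ))⁻¹ = (n : ℝ)⁻¹ := by
    rw [← mul_inv, Real.mul_self_sqrt (Nat.cast_nonneg n)]
  simp only [sampleMean, normSum, Finset.sum_sub_distrib, Finset.sum_const, Finset.card_range,
    nsmul_eq_mul]
  rw [div_eq_mul_inv _ (√(n : ℝ)), mul_comm (√(n : ℝ))⁻¹, mul_assoc, h1]
  field_simp
  ring

namespace IsIIDSample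

theorem bddInProb_normSum_sub (hZ : IsIIDSample P Q Z) {g : 𝒵 → ℝ} (hg : MemLp g 2 Q) :
    BddInProb P fun p => normSum (fun z => g z - ∫ y, g y ∂Q) p.1 fun i => Z i p.2 := by
  have := hZ.isProbabilityMeasure
  refine hZ.bddInProb_normSum (hg.sub (memLp_const _)) ?_
  rw [integral_sub (hg.integrable one_le_two) (integrable_const _)]
  simp

/-- Weak law of large numbers. -/
theorem tendsto_sampleMean (hZ : IsIIDSample P Q Z) {g : 𝒵 → ℝ} (hg : MemLp g 2 Q) :
    Tendsto (fun p : ℕ × Ω => sampleMean g p.1 fun i => Z i p.2) (whp P) (𝓝 (∫ z, g z ∂Q)) := by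
  have h := ((hZ.bddInProb_normSum_sub hg).tendsto_rate_mul).const_add (∫ z, g z ∂Q)
  rw [add_zero] at h
  refine h.congr' ?_
  filter_upwards [eventually_pos_whp] with p hp
  exact (sampleMean_eq_add_rate_mul g _ hp _).symm

end IsIIDSample

end Sample

/-! ### The uniform law of large numbers and consistency of maximizers -/

/-- A `C(K, ℝ)`-valued map is measurable as soon as its evaluations are. -/
theorem measurable_continuousMap_of_eval {K α : Type*} [TopologicalSpace K] [CompactSpace K]
    [SecondCountableTopology K] [T2Space K] [MeasurableSpace α] [MeasurableSpace C(K, ℝ)]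
    [BorelSpace C(K, ℝ)]
    {F : α → C(K, ℝ)} (hF : ∀ x, Measurable fun a => F a x) : Measurable F := by
  have hdist : ∀ g : C(K, ℝ), Measurable fun a => dist (F a) g := by
    intro g
    refine measurable_of_Iic fun r => ?_
    rcases lt_or_ge r 0 with hr | hr
    · convert MeasurableSet.empty
      ext a
      simpa using hr.trans_le dist_nonneg
    · obtain ⟨D, hDc, hDd⟩ := TopologicalSpace.exists_countable_dense K
      have : (fun a => dist (F a) g) ⁻¹' Set.Iic r
          = ⋂ x ∈ D, {a | dist (F a x) (g x) ≤ r} := by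
        ext a
        simp only [Set.mem_preimage, Set.mem_Iic, Set.mem_iInter, Set.mem_ofPred_eq]
        rw [ContinuousMap.dist_le hr]
        refine ⟨fun h x _ => h x, fun h => ?_⟩
        have hcl : IsClosed {x | dist (F a x) (g x) ≤ r} :=
          isClosed_le (by fun_prop) continuous_const
        intro x
        exact hcl.closure_subset_iff.2 h (hDd x)
      rw [this]
      refine MeasurableSet.biInter hDc fun x _ => ?_
      exact measurableSet_le ((hF x).dist measurable_const) measurable_const
  have hb : TopologicalSpace.IsTopologicalBasis
      {s : Set C(K, ℝ) | ∃ x r, s = Metric.ball x r} := by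
    refine TopologicalSpace.isTopologicalBasis_of_isOpen_of_nhds ?_ ?_
    · rintro _ ⟨x, r, rfl⟩
      exact Metric.isOpen_ball
    · intro a u ha hu
      obtain ⟨r, hr, h⟩ := Metric.isOpen_iff.1 hu a ha
      exact ⟨_, ⟨a, r, rfl⟩, Metric.mem_ball_self hr, h⟩
  rw [BorelSpace.measurable_eq (α := C(K, ℝ)), hb.borel_eq_generateFrom]
  refine measurable_generateFrom ?_
  rintro _ ⟨x, r, rfl⟩
  exact measurableSet_lt (hdist x) measurable_const

section Uniform

variable {𝒵 Ω : Type*} [MeasurableSpace 𝒵] [MeasurableSpace Ω] {P : Measure Ω}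
  [IsProbabilityMeasure P] {Q : Measure 𝒵} {Z : ℕ → Ω → 𝒵}

/-- Uniform law of large numbers over a compact set, obtained from the strong law of large numbers
in the separable Banach space `C(K, ℝ)`. -/
theorem IsIIDSample.uniform_law_of_large_numbers (hZ : IsIIDSample P Q Z) {K : Set ℝ}
    (hK : IsCompact K) {h : 𝒵 → ℝ → ℝ} (hc : ∀ z, ContinuousOn (h z) K)
    (hm : ∀ θ ∈ K, Measurable fun z => h z θ) {M : 𝒵 → ℝ} (hM : Integrable M Q)
    (hb : ∀ z, ∀ θ ∈ K, |h z θ| ≤ M z) :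
    ContinuousOn (fun θ => ∫ z, h z θ ∂Q) K ∧ ∀ η > 0, ∀ᶠ p in whp P, ∀ θ ∈ K,
      |sampleMean (fun z => h z θ) p.1 (fun i => Z i p.2) - ∫ z, h z θ ∂Q| < η := by
  have : CompactSpace K := isCompact_iff_compactSpace.1 hK
  let : MeasurableSpace C(K, ℝ) := borel _
  have : BorelSpace C(K, ℝ) := ⟨rfl⟩
  set G : 𝒵 → C(K, ℝ) := fun z => ⟨K.domRestrict (h z), (hc z).domRestrict⟩ with hG
  have hGm : Measurable G := measurable_continuousMap_of_eval fun θ => hm θ θ.2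
  have hGi : ∀ i, Integrable (fun ω => G (Z i ω)) P := fun i => by
    refine ⟨(hGm.comp (hZ.measurable i)).aestronglyMeasurable, ?_⟩
    exact ContinuousMap.hasFiniteIntegral_of_bound _ (fun ω => M (Z i ω))
      ((hZ.measurePreserving i).integrable_comp_of_integrable hM).2
      (ae_of_all _ fun ω θ => hb _ θ θ.2)
  have hlaw := strong_law_ae (μ := P) (fun i ω => G (Z i ω)) (hGi 0)
    (fun i j hij => (hZ.indep.indepFun hij).comp hGm hGm)
    (fun i => (IdentDistrib.mk (hZ.measurable i).aemeasurable (hZ.measurable 0).aemeasurable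
      (by rw [hZ.law, hZ.law])).comp hGm)
  have hev : ∀ θ : K, (∫ ω, G (Z 0 ω) ∂P) θ = ∫ z, h z θ ∂Q := fun θ => by
    have h1 := (ContinuousMap.evalCLM ℝ θ : C(K, ℝ) →L[ℝ] ℝ).integral_comp_comm (hGi 0)
    have h2 : ∫ z, h z θ ∂Q = ∫ ω, h (Z 0 ω) θ ∂P := by
      rw [← hZ.law 0, integral_map (hZ.measurable 0).aemeasurable
        (hm θ θ.2).aestronglyMeasurable]
    rw [h2]
    exact h1.symm
  constructor
  · rw [continuousOn_iff_continuous_domRestrict]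
    exact (∫ ω, G (Z 0 ω) ∂P).continuous.congr hev
  · intro η hη
    have hmeas := tendstoInMeasure_of_tendsto_ae
      (f := fun n ω => (n : ℝ)⁻¹ • ∑ i ∈ Finset.range n, G (Z i ω))
      (fun n => (((integrable_finsetSum _ fun i _ => hGi i).smul (n : ℝ)⁻¹)).1) hlaw
    have := hmeas (ENNReal.ofReal η) (ENNReal.ofReal_pos.2 hη)
    rw [eventually_whp]
    refine tendsto_of_tendsto_of_tendsto_of_le_of_le tendsto_const_nhds this
      (fun _ => zero_le) fun n => measure_mono fun ω hω => ?_
    by_contra hcon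
    apply hω
    intro θ hθ
    have hlt : dist ((n : ℝ)⁻¹ • ∑ i ∈ Finset.range n, G (Z i ω)) (∫ ω, G (Z 0 ω) ∂P) < η := by
      have hcon' : ¬ ENNReal.ofReal η ≤ edist ((n : ℝ)⁻¹ • ∑ i ∈ Finset.range n, G (Z i ω))
          (∫ ω, G (Z 0 ω) ∂P) := hcon
      rwa [not_le, edist_dist, ENNReal.ofReal_lt_ofReal_iff hη] at hcon'
    have := (ContinuousMap.dist_apply_le_dist (⟨θ, hθ⟩ : K)).trans_lt hlt
    rw [hev, Real.dist_eq] at this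
    have hval : ((n : ℝ)⁻¹ • ∑ i ∈ Finset.range n, G (Z i ω)) ⟨θ, hθ⟩
        = sampleMean (fun z => h z θ) n fun i => Z i ω := by
      simp [sampleMean, hG, div_eq_inv_mul]
    rwa [hval] at this

/-- Consistency: if the population criterion has a unique maximizer over `K`, every sequence of
maximizers of the sample criterion converges to it in probability. -/
theorem IsIIDSample.tendsto_argmax (hZ : IsIIDSample P Q Z) {K : Set ℝ}
    (hK : IsCompact K) {h : 𝒵 → ℝ → ℝ} (hc : ∀ z, ContinuousOn (h z) K)
    (hm : ∀ θ ∈ K, Measurable fun z => h z θ) {M : 𝒵 → ℝ} (hM : Integrable M Q)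
    (hb : ∀ z, ∀ θ ∈ K, |h z θ| ≤ M z) {θ₀ : ℝ} (hθ₀ : θ₀ ∈ K)
    (hmax : ∀ θ ∈ K, θ ≠ θ₀ → ∫ z, h z θ ∂Q < ∫ z, h z θ₀ ∂Q) {T : ℕ → Ω → ℝ}
    (hT : ∀ n ω, T n ω ∈ K ∧
      IsMaxOn (fun θ => sampleMean (fun z => h z θ) n fun i => Z i ω) K (T n ω)) :
    Tendsto (fun p : ℕ × Ω => T p.1 p.2) (whp P) (𝓝 θ₀) := by
  obtain ⟨hLc, hU⟩ := hZ.uniform_law_of_large_numbers hK hc hm hM hb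
  rw [Metric.tendsto_nhds]
  intro ε hε
  -- the population criterion is bounded away from its maximum outside the `ε`-ball
  obtain ⟨η, hη, hsep⟩ : ∃ η > 0, ∀ θ ∈ K, ε ≤ dist θ θ₀ →
      ∫ z, h z θ ∂Q + 2 * η ≤ ∫ z, h z θ₀ ∂Q := by
    set K' := K ∩ {θ | ε ≤ dist θ θ₀}
    have hK' : IsCompact K' := hK.inter_right (isClosed_le continuous_const (by fun_prop))
    rcases K'.eq_empty_or_nonempty with he | hne
    · refine ⟨1, one_pos, fun θ hθ hd => ?_⟩
      exact absurd (show θ ∈ K' from ⟨hθ, hd⟩) (he ▸ Set.notMem_empty θ)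
    · obtain ⟨θ₁, hθ₁, hθ₁max⟩ := hK'.exists_isMaxOn hne (hLc.mono Set.inter_subset_left)
      have hlt := hmax θ₁ hθ₁.1 (by
        rintro rfl
        have := hθ₁.2
        simp only [Set.mem_ofPred_eq, dist_self] at this
        linarith)
      refine ⟨(∫ z, h z θ₀ ∂Q - ∫ z, h z θ₁ ∂Q) / 2, by linarith, fun θ hθ hd => ?_⟩
      have : ∫ z, h z θ ∂Q ≤ ∫ z, h z θ₁ ∂Q := hθ₁max ⟨hθ, hd⟩
      linarith
  filter_upwards [hU η hη] with p hp
  by_contra hcon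
  obtain ⟨hTK, hTmax⟩ := hT p.1 p.2
  have h1 := hsep _ hTK (not_lt.1 hcon)
  have h2 := abs_lt.1 (hp _ hTK)
  have h3 := abs_lt.1 (hp _ hθ₀)
  have h4 : sampleMean (fun z => h z θ₀) p.1 (fun i => Z i p.2)
      ≤ sampleMean (fun z => h z (T p.1 p.2)) p.1 (fun i => Z i p.2) := hTmax hθ₀
  linarith [h2.1, h2.2, h3.1, h3.2]

end Uniform

/-! ### Regularity of the model -/

theorem iteratedDerivWithin_eq_iteratedDeriv_of_mem_interior {g : ℝ → ℝ} {s : Set ℝ} {θ : ℝ}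
    (hθ : θ ∈ interior s) (m : ℕ) : iteratedDerivWithin m g s θ = iteratedDeriv m g θ := by
  have h : s =ᶠ[𝓝 θ] Set.univ := eventuallyEq_univ.2 (mem_interior_iff_mem_nhds.1 hθ)
  rw [← iteratedDerivWithin_univ, iteratedDerivWithin, iteratedDerivWithin,
    iteratedFDerivWithin_congr_set h]

theorem holderTriple_four_four_two : ENNReal.HolderTriple 4 4 2 := ⟨by
  rw [← two_mul, show (4 : ENNReal) = 2 * 2 by norm_num,
    ENNReal.mul_inv (by simp) (by simp), ← mul_assoc, ENNReal.mul_inv_cancel (by simp) (by simp),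
    one_mul]⟩

namespace RegularModel

variable {𝒵 : Type*} [MeasurableSpace 𝒵] {ν : Measure 𝒵} {f : 𝒵 → ℝ → ℝ} {Θ : Set ℝ} {θ₀ : ℝ}

theorem mem (hreg : RegularModel ν f Θ θ₀) : θ₀ ∈ Θ := interior_subset hreg.interior

theorem hasDerivAt_logDeriv (hreg : RegularModel ν f Θ θ₀) (z : 𝒵) {θ : ℝ}
    (hθ : θ ∈ _root_.interior Θ) {m : ℕ} (hm : m < 7) :
    HasDerivAt (logDeriv f Θ m z) (logDeriv f Θ (m + 1) z θ) θ := by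
  have hev : logDeriv f Θ m z =ᶠ[𝓝 θ] iteratedDeriv m fun t => Real.log (f z t) := by
    filter_upwards [isOpen_interior.mem_nhds hθ] with t ht
    exact iteratedDerivWithin_eq_iteratedDeriv_of_mem_interior ht m
  have hc : ContDiffWithinAt ℝ 7 (fun t => Real.log (f z t)) Set.univ θ :=
    ((hreg.smooth z).contDiffAt (mem_interior_iff_mem_nhds.1 hθ)).contDiffWithinAt
  have hd := hc.differentiableWithinAt_iteratedDerivWithin (m := m) (by exact_mod_cast hm)
    (by simp)
  rw [differentiableWithinAt_univ, iteratedDerivWithin_univ] at hd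
  rw [logDeriv, iteratedDerivWithin_eq_iteratedDeriv_of_mem_interior hθ, iteratedDeriv_succ]
  exact hd.hasDerivAt.congr_of_eventuallyEq hev

theorem isProbabilityMeasure_law (hreg : RegularModel ν f Θ θ₀) :
    IsProbabilityMeasure (law ν f θ₀) :=
  ⟨by rw [law, withDensity_apply _ MeasurableSet.univ, Measure.restrict_univ,
    hreg.lintegral_density θ₀ hreg.mem]⟩

/-- The envelope has a finite fourth moment, so that products of two derivatives of the log-density
are square-integrable. -/
theorem exists_envelope (hreg : RegularModel ν f Θ θ₀) :
    ∃ M : 𝒵 → ℝ, (∀ z, ∀ θ ∈ Θ, ∀ m ≤ 7, |logDeriv f Θ m z θ| ≤ M z) ∧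
      MemLp M 4 (law ν f θ₀) := by
  have := hreg.isProbabilityMeasure_law
  obtain ⟨M, hM, q, hq, hint⟩ := hreg.envelope
  have hM0 : ∀ z, 0 ≤ M z := fun z => (abs_nonneg _).trans (hM z θ₀ hreg.mem 0 (by norm_num))
  refine ⟨M, hM, ?_⟩
  have hq0 : 0 < q := by linarith
  have hmeas : AEStronglyMeasurable M (law ν f θ₀) := by
    have h := (hint.aestronglyMeasurable.aemeasurable.pow_const q⁻¹).aestronglyMeasurable
    refine h.congr (ae_of_all _ fun z => ?_)
    exact Real.rpow_rpow_inv (hM0 z) hq0.ne'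
  have hLq : MemLp M (ENNReal.ofReal q) (law ν f θ₀) := by
    rw [← integrable_norm_rpow_iff hmeas (by simpa using hq0) ENNReal.ofReal_ne_top,
      ENNReal.toReal_ofReal hq0.le]
    simpa only [Real.norm_of_nonneg (hM0 _)] using hint
  refine hLq.mono_exponent ?_
  rw [← ENNReal.ofReal_ofNat]
  exact ENNReal.ofReal_le_ofReal (by linarith)

theorem memLp_logDeriv (hreg : RegularModel ν f Θ θ₀) {m : ℕ} (hm : m ≤ 7) {θ : ℝ} (hθ : θ ∈ Θ) :
    MemLp (fun z => logDeriv f Θ m z θ) 4 (law ν f θ₀) := by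
  obtain ⟨M, hM, hL⟩ := hreg.exists_envelope
  refine hL.mono (hreg.measurable_deriv θ hθ m hm).aestronglyMeasurable (ae_of_all _ fun z => ?_)
  rw [Real.norm_eq_abs, Real.norm_eq_abs]
  exact (hM z θ hθ m hm).trans (le_abs_self _)

theorem memLp_two_logDeriv (hreg : RegularModel ν f Θ θ₀) {m : ℕ} (hm : m ≤ 7) {θ : ℝ}
    (hθ : θ ∈ Θ) : MemLp (fun z => logDeriv f Θ m z θ) 2 (law ν f θ₀) := by
  have := hreg.isProbabilityMeasure_law
  exact (hreg.memLp_logDeriv hm hθ).mono_exponent (by norm_num)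

theorem memLp_logDeriv_mul (hreg : RegularModel ν f Θ θ₀) {m k : ℕ} (hm : m ≤ 7) (hk : k ≤ 7)
    {θ : ℝ} (hθ : θ ∈ Θ) :
    MemLp (fun z => logDeriv f Θ m z θ * logDeriv f Θ k z θ) 2 (law ν f θ₀) := by
  have := holderTriple_four_four_two
  exact (hreg.memLp_logDeriv hk hθ).mul' (hreg.memLp_logDeriv hm hθ)

/-- The Kullback-Leibler inequality: the expected log-likelihood is uniquely maximal at `θ₀`. -/
theorem integral_log_lt (hreg : RegularModel ν f Θ θ₀) {θ : ℝ} (hθ : θ ∈ Θ) (hne : θ ≠ θ₀) :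
    ∫ z, Real.log (f z θ) ∂(law ν f θ₀) < ∫ z, Real.log (f z θ₀) ∂(law ν f θ₀) := by
  have := hreg.isProbabilityMeasure_law
  have hlog : ∀ t ∈ Θ, Integrable (fun z => Real.log (f z t)) (law ν f θ₀) := fun t ht => by
    simpa [logDeriv] using (hreg.memLp_two_logDeriv (m := 0) (by norm_num) ht).integrable
      one_le_two
  have hp := fun z => hreg.pos z θ hθ
  have hp₀ := fun z => hreg.pos z θ₀ hreg.mem
  have hm := hreg.measurable_density θ hθ
  have hm₀ := hreg.measurable_density θ₀ hreg.mem
  have hrm : Measurable fun z => f z θ / f z θ₀ := hm.div hm₀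
  have hl : ∫⁻ z, ENNReal.ofReal (f z θ / f z θ₀) ∂(law ν f θ₀) = 1 := by
    rw [law, lintegral_withDensity_eq_lintegral_mul _ hm₀.ennreal_ofReal
      hrm.ennreal_ofReal, ← hreg.lintegral_density θ hθ]
    refine lintegral_congr fun z => ?_
    rw [Pi.mul_apply, ← ENNReal.ofReal_mul (hp₀ z).le, mul_div_cancel₀ _ (hp₀ z).ne']
  have hr0 : ∀ z, 0 ≤ f z θ / f z θ₀ := fun z => (div_pos (hp z) (hp₀ z)).le
  have hri : Integrable (fun z => f z θ / f z θ₀) (law ν f θ₀) := by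
    rw [← lintegral_ofReal_ne_top_iff_integrable hrm.aestronglyMeasurable
      (ae_of_all _ hr0), hl]
    exact ENNReal.one_ne_top
  have hr1 : ∫ z, f z θ / f z θ₀ ∂(law ν f θ₀) = 1 := by
    rw [integral_eq_lintegral_of_nonneg_ae (ae_of_all _ hr0) hri.1, hl, ENNReal.toReal_one]
  by_contra hcon
  -- the gap `r - 1 - log r ≥ 0` of the likelihood ratio `r` then integrates to zero
  set φ : 𝒵 → ℝ := fun z => f z θ / f z θ₀ - 1 - (Real.log (f z θ) - Real.log (f z θ₀)) with hφ
  have hφ0 : ∀ z, 0 ≤ φ z := fun z => by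
    have h := Real.log_le_sub_one_of_pos (div_pos (hp z) (hp₀ z))
    rw [Real.log_div (hp z).ne' (hp₀ z).ne'] at h
    simp only [hφ]
    linarith
  have hi1 : Integrable (fun z => f z θ / f z θ₀ - 1) (law ν f θ₀) :=
    hri.sub (integrable_const 1)
  have hi2 : Integrable (fun z => Real.log (f z θ) - Real.log (f z θ₀)) (law ν f θ₀) :=
    (hlog θ hθ).sub (hlog θ₀ hreg.mem)
  have hφi : Integrable φ (law ν f θ₀) := hi1.sub hi2
  have hφint : ∫ z, φ z ∂(law ν f θ₀) = 0 := by
    refine le_antisymm ?_ (integral_nonneg hφ0)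
    simp only [hφ]
    rw [integral_sub hi1 hi2, integral_sub hri (integrable_const 1),
      integral_sub (hlog θ hθ) (hlog θ₀ hreg.mem), hr1]
    simp only [integral_const, probReal_univ, smul_eq_mul, mul_one]
    linarith
  rw [integral_eq_zero_iff_of_nonneg_ae (ae_of_all _ hφ0) hφi] at hφint
  refine hreg.identified θ hθ hne ?_
  filter_upwards [hφint] with z hz
  by_contra hzne
  have h := Real.log_lt_sub_one_of_pos (div_pos (hp z) (hp₀ z))
    (fun h => hzne ((div_eq_one_iff_eq (hp₀ z).ne').1 h))
  rw [Real.log_div (hp z).ne' (hp₀ z).ne'] at h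
  simp only [hφ, Pi.zero_apply] at hz
  linarith

/-- The score has mean zero, because `θ₀` is an interior maximizer of the expected
log-likelihood, which may be differentiated under the integral sign. -/
theorem integral_ell (hreg : RegularModel ν f Θ θ₀) :
    ∫ z, ell f Θ z θ₀ ∂(law ν f θ₀) = 0 := by
  have := hreg.isProbabilityMeasure_law
  obtain ⟨M, hM, hL⟩ := hreg.exists_envelope
  have hnhds : _root_.interior Θ ∈ 𝓝 θ₀ := isOpen_interior.mem_nhds hreg.interior
  have hd := (hasDerivAt_integral_of_dominated_loc_of_deriv_le (μ := law ν f θ₀)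
    (F := fun θ z => logDeriv f Θ 0 z θ) (F' := fun θ z => logDeriv f Θ 1 z θ) (bound := M)
    hnhds (by
      filter_upwards [hnhds] with θ hθ
      exact (hreg.memLp_logDeriv (by norm_num) (interior_subset hθ)).1)
    ((hreg.memLp_two_logDeriv (by norm_num) hreg.mem).integrable one_le_two)
    (hreg.memLp_logDeriv (by norm_num) hreg.mem).1
    (ae_of_all _ fun z θ hθ => hM z θ (interior_subset hθ) 1 (by norm_num))
    (hL.integrable (by norm_num))
    (ae_of_all _ fun z θ hθ => hreg.hasDerivAt_logDeriv z hθ (by norm_num))).2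
  refine IsLocalMax.hasDerivAt_eq_zero ?_ hd
  filter_upwards [hnhds] with θ hθ
  rcases eq_or_ne θ θ₀ with rfl | hne
  · exact le_rfl
  · simpa [logDeriv] using (hreg.integral_log_lt (interior_subset hθ) hne).le

/-- Two derivatives of the density in terms of those of its logarithm. -/
theorem iteratedDerivWithin_two_density (hreg : RegularModel ν f Θ θ₀) (z : 𝒵) :
    iteratedDerivWithin 2 (fun θ => f z θ) Θ θ₀
      = f z θ₀ * (ell1 f Θ z θ₀ + ell f Θ z θ₀ ^ 2) := by
  have h1 : ∀ θ ∈ _root_.interior Θ, HasDerivAt (fun t => f z t) (f z θ * logDeriv f Θ 1 z θ) θ := by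
    intro θ hθ
    have hexp := (hreg.hasDerivAt_logDeriv z hθ (m := 0) (by norm_num)).exp
    have hfexp : ∀ t ∈ Θ, Real.exp (logDeriv f Θ 0 z t) = f z t := fun t ht => by
      simpa [logDeriv] using Real.exp_log (hreg.pos z t ht)
    rw [hfexp θ (interior_subset hθ)] at hexp
    refine hexp.congr_of_eventuallyEq ?_
    filter_upwards [isOpen_interior.mem_nhds hθ] with t ht
    exact (hfexp t (interior_subset ht)).symm
  have h2 : deriv (fun t => f z t) =ᶠ[𝓝 θ₀] fun t => f z t * logDeriv f Θ 1 z t := by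
    filter_upwards [isOpen_interior.mem_nhds hreg.interior] with t ht
    exact (h1 t ht).deriv
  have h3 : HasDerivAt (fun t => f z t * logDeriv f Θ 1 z t) _ θ₀ :=
    (h1 θ₀ hreg.interior).mul (hreg.hasDerivAt_logDeriv z hreg.interior (m := 1) (by norm_num))
  rw [iteratedDerivWithin_eq_iteratedDeriv_of_mem_interior hreg.interior, iteratedDeriv_succ,
    iteratedDeriv_one, h2.deriv_eq, h3.deriv]
  simp only [ell, ell1]
  ring

/-- The information equality. -/
theorem integral_ell_sq (hreg : RegularModel ν f Θ θ₀)
    (hswap : ∫ z, iteratedDerivWithin 2 (fun θ => f z θ) Θ θ₀ ∂ν = 0) :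
    ∫ z, ell f Θ z θ₀ ^ 2 ∂(law ν f θ₀) = info ν f Θ θ₀ := by
  have := hreg.isProbabilityMeasure_law
  have h1 : ∫ z, (ell1 f Θ z θ₀ + ell f Θ z θ₀ ^ 2) ∂(law ν f θ₀) = 0 := by
    rw [law, integral_withDensity_eq_integral_toReal_smul
      (hreg.measurable_density θ₀ hreg.mem).ennreal_ofReal
      (ae_of_all _ fun _ => ENNReal.ofReal_lt_top), ← hswap]
    refine integral_congr_ae (ae_of_all _ fun z => ?_)
    simp only
    rw [hreg.iteratedDerivWithin_two_density, ENNReal.toReal_ofReal (hreg.pos z θ₀ hreg.mem).le,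
      smul_eq_mul]
  have hi : Integrable (fun z => ell f Θ z θ₀ ^ 2) (law ν f θ₀) := by
    simpa [ell, sq] using
      (hreg.memLp_logDeriv_mul (m := 1) (k := 1) (by norm_num) (by norm_num)
        hreg.mem).integrable one_le_two
  have hi1 : Integrable (fun z => ell1 f Θ z θ₀) (law ν f θ₀) :=
    (hreg.memLp_two_logDeriv (m := 2) (by norm_num) hreg.mem).integrable one_le_two
  rw [integral_add hi1 hi] at h1
  rw [info, E]
  linarith

end RegularModel

/-! ### Taylor expansions -/

/-- Taylor's theorem for a chain `g 0, g 1, …` of functions each of which is the derivative of the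
preceding one. The constant of the remainder is not the optimal one. -/
theorem abs_sub_taylor_le {θ₀ r C : ℝ} {k : ℕ} {g : ℕ → ℝ → ℝ}
    (hd : ∀ j < k, ∀ t ∈ Metric.ball θ₀ r, HasDerivAt (g j) (g (j + 1) t) t)
    (hb : ∀ t ∈ Metric.ball θ₀ r, |g k t| ≤ C) {t : ℝ} (ht : t ∈ Metric.ball θ₀ r) :
    |g 0 t - ∑ j ∈ Finset.range k, g j θ₀ * (t - θ₀) ^ j / j.factorial| ≤ C * |t - θ₀| ^ k := by
  induction k generalizing g t with
  | zero => simpa using hb t ht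
  | succ k ih =>
    set R : ℝ → ℝ := fun s =>
      g 0 s - ∑ j ∈ Finset.range (k + 1), g j θ₀ * (s - θ₀) ^ j / j.factorial with hR
    have hRd : ∀ s ∈ Metric.ball θ₀ r, HasDerivAt R
        (g 1 s - ∑ j ∈ Finset.range k, g (j + 1) θ₀ * (s - θ₀) ^ j / j.factorial) s := by
      intro s hs
      refine (hd 0 (Nat.succ_pos k) s hs).sub ?_
      simp only [Finset.sum_range_succ', pow_zero, mul_one]
      refine HasDerivAt.add_const _ (HasDerivAt.fun_sum fun j _ => ?_)
      have h := ((((hasDerivAt_id s).sub_const θ₀).pow (j + 1)).const_mul (g (j + 1) θ₀)).div_const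
        ((j + 1).factorial : ℝ)
      refine h.congr_deriv ?_
      have h1 : (j.factorial : ℝ) ≠ 0 := by exact_mod_cast j.factorial_ne_zero
      have h2 : (j : ℝ) + 1 ≠ 0 := by positivity
      rw [Nat.factorial_succ]
      push_cast
      simp only [id]
      field_simp
    have hR0 : R θ₀ = 0 := by
      simp [hR, Finset.sum_range_succ']
    have hC : 0 ≤ C := (abs_nonneg _).trans (hb t ht)
    have hsub : Metric.closedBall θ₀ |t - θ₀| ⊆ Metric.ball θ₀ r := by
      refine Metric.closedBall_subset_ball ?_
      rwa [← Real.dist_eq]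
    have hmv := (convex_closedBall θ₀ |t - θ₀|).norm_image_sub_le_of_norm_hasDerivWithin_le
      (f := R) (C := C * |t - θ₀| ^ k) (x := θ₀) (y := t)
      (fun s hs => (hRd s (hsub hs)).hasDerivWithinAt) (fun s hs => ?_)
      (Metric.mem_closedBall_self (abs_nonneg _)) (by simp [Real.dist_eq])
    · rw [hR0, sub_zero, Real.norm_eq_abs, Real.norm_eq_abs] at hmv
      rwa [pow_succ, ← mul_assoc]
    · have h := ih (g := fun j => g (j + 1)) (fun j hj => hd (j + 1) (Nat.succ_lt_succ hj)) hb
        (hsub hs)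
      rw [Real.norm_eq_abs]
      refine h.trans ?_
      have hs' : |s - θ₀| ≤ |t - θ₀| := by rw [← Real.dist_eq]; exact hs
      gcongr

section SampleMean

variable {𝒵 : Type*} {n : ℕ} {x : ℕ → 𝒵}

theorem abs_sampleMean_le {g N : 𝒵 → ℝ} (h : ∀ z, |g z| ≤ N z) :
    |sampleMean g n x| ≤ sampleMean N n x := by
  rw [sampleMean, sampleMean, abs_div, Nat.abs_cast]
  gcongr
  exact (Finset.abs_sum_le_sum_abs _ _).trans (Finset.sum_le_sum fun i _ => h _)

theorem hasDerivAt_sampleMean {g g' : 𝒵 → ℝ → ℝ} {θ : ℝ}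
    (h : ∀ z, HasDerivAt (g z) (g' z θ) θ) :
    HasDerivAt (fun t => sampleMean (fun z => g z t) n x) (sampleMean (fun z => g' z θ) n x) θ :=
  (HasDerivAt.fun_sum fun i _ => h (x i)).div_const _

end SampleMean

/-! ### First-order stochastic expansions -/

section Expansion

variable {Ω : Type*} [MeasurableSpace Ω] {P : Measure Ω}

/-- `X = a₀ + n^{-1/2} a₁ + O_p(n⁻¹)` with a constant `a₀` and `a₁ = O_p(1)`. -/
def HasExpansion (P : Measure Ω) (X : ℕ × Ω → ℝ) (a₀ : ℝ) (a₁ : ℕ × Ω → ℝ) : Prop :=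
  BddInProb P a₁ ∧ ∃ R : ℕ × Ω → ℝ, BddInProb P R ∧
    ∀ᶠ p in whp P, X p = a₀ + rate p * a₁ p + rate p ^ 2 * R p

namespace HasExpansion

variable {X Y a₁ b₁ : ℕ × Ω → ℝ} {a₀ b₀ : ℝ}

theorem tendsto (hX : HasExpansion P X a₀ a₁) : Tendsto X (whp P) (𝓝 a₀) := by
  obtain ⟨ha, R, hR, h⟩ := hX
  have h1 := ha.tendsto_rate_mul
  have h2 := (BddInProb.rate.mul hR).tendsto_rate_mul
  have h3 := (h1.add h2).const_add a₀
  rw [add_zero, add_zero] at h3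
  refine h3.congr' ?_
  filter_upwards [h] with p hp
  rw [hp]
  ring

theorem bddInProb (hX : HasExpansion P X a₀ a₁) : BddInProb P X := .of_tendsto hX.tendsto

theorem const (a : ℝ) : HasExpansion P (fun _ => a) a fun _ => 0 :=
  ⟨.const 0, fun _ => 0, .const 0, Eventually.of_forall fun p => by ring⟩

theorem add (hX : HasExpansion P X a₀ a₁) (hY : HasExpansion P Y b₀ b₁) :
    HasExpansion P (fun p => X p + Y p) (a₀ + b₀) fun p => a₁ p + b₁ p := by
  obtain ⟨ha, R, hR, h⟩ := hX
  obtain ⟨hb, S, hS, h'⟩ := hY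
  refine ⟨ha.add hb, fun p => R p + S p, hR.add hS, ?_⟩
  filter_upwards [h, h'] with p hp hp'
  rw [hp, hp']
  ring

theorem mul (hX : HasExpansion P X a₀ a₁) (hY : HasExpansion P Y b₀ b₁) :
    HasExpansion P (fun p => X p * Y p) (a₀ * b₀) fun p => a₀ * b₁ p + b₀ * a₁ p := by
  obtain ⟨ha, R, hR, h⟩ := id hX
  have hYb := hY.bddInProb
  obtain ⟨hb, S, hS, h'⟩ := hY
  refine ⟨(hb.const_mul a₀).add (ha.const_mul b₀),
    fun p => a₀ * S p + a₁ p * (b₁ p + rate p * S p) + R p * Y p,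
    ((hS.const_mul a₀).add (ha.mul (hb.add (BddInProb.rate.mul hS)))).add (hR.mul hYb), ?_⟩
  filter_upwards [h, h'] with p hp hp'
  rw [hp, hp']
  ring

theorem const_mul (c : ℝ) (hX : HasExpansion P X a₀ a₁) :
    HasExpansion P (fun p => c * X p) (c * a₀) fun p => c * a₁ p := by
  simpa using (const c).mul hX

theorem inv (hX : HasExpansion P X a₀ a₁) (h0 : a₀ ≠ 0) :
    HasExpansion P (fun p => (X p)⁻¹) a₀⁻¹ fun p => -(a₀⁻¹ ^ 2) * a₁ p := by
  have hinv := hX.tendsto.inv₀ h0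
  have hne := hX.tendsto.eventually_ne h0
  obtain ⟨ha, R, hR, h⟩ := hX
  have hk : BddInProb P fun p => (X p)⁻¹ := .of_tendsto hinv
  refine ⟨ha.const_mul _,
    fun p => a₀⁻¹ ^ 2 * ((X p)⁻¹ * (a₁ p * (a₁ p + rate p * R p))) - a₀⁻¹ * ((X p)⁻¹ * R p),
    ((hk.mul (ha.mul (ha.add (BddInProb.rate.mul hR)))).const_mul _).sub
      ((hk.mul hR).const_mul _), ?_⟩
  filter_upwards [h, hne] with p hp hp0
  have hk1 : (X p)⁻¹ * (a₀ + rate p * a₁ p + rate p ^ 2 * R p) = 1 := by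
    rw [← hp, inv_mul_cancel₀ hp0]
  have ha1 : a₀⁻¹ * a₀ = 1 := inv_mul_cancel₀ h0
  have h1 : (X p)⁻¹ = a₀⁻¹ - a₀⁻¹ * (X p)⁻¹ * (rate p * a₁ p + rate p ^ 2 * R p) := by
    linear_combination a₀⁻¹ * hk1 - (X p)⁻¹ * ha1
  linear_combination h1 - a₀⁻¹ * (rate p * a₁ p) * h1

end HasExpansion

omit [MeasurableSpace Ω] in
theorem rate_sq_mul_natCast {p : ℕ × Ω} (hp : 0 < p.1) : rate p ^ 2 * (p.1 : ℝ) = 1 := by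
  have : (p.1 : ℝ) ≠ 0 := by positivity
  rw [rate, inv_pow, Real.sq_sqrt (Nat.cast_nonneg _), inv_mul_cancel₀ this]

variable [IsProbabilityMeasure P] {𝒵 : Type*} [MeasurableSpace 𝒵] {Q : Measure 𝒵}
  {Z : ℕ → Ω → 𝒵}

/-- The sample average of a smooth function `g 0`, with derivatives `g 1` and `g 2`, at an estimator
`T` with the expansion `T = θ₀ + n^{-1/2} A + O_p(n⁻¹)`. -/
theorem HasExpansion.sampleMean_comp (hZ : IsIIDSample P Q Z) {g : ℕ → 𝒵 → ℝ → ℝ} {N : 𝒵 → ℝ}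
    {θ₀ r : ℝ} (hr : 0 < r)
    (hd : ∀ j < 2, ∀ z, ∀ t ∈ Metric.ball θ₀ r, HasDerivAt (g j z) (g (j + 1) z t) t)
    (hb : ∀ z, ∀ t ∈ Metric.ball θ₀ r, |g 2 z t| ≤ N z) (hN : MemLp N 2 Q)
    (h0 : MemLp (fun z => g 0 z θ₀) 2 Q) (h1 : MemLp (fun z => g 1 z θ₀) 2 Q)
    {T A : ℕ × Ω → ℝ} (hT : HasExpansion P T θ₀ A) :
    HasExpansion P (fun p => sampleMean (fun z => g 0 z (T p)) p.1 fun i => Z i p.2)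
      (∫ z, g 0 z θ₀ ∂Q)
      fun p => normSum (fun z => g 0 z θ₀ - ∫ y, g 0 y θ₀ ∂Q) p.1 (fun i => Z i p.2)
        + (∫ z, g 1 z θ₀ ∂Q) * A p := by
  have hball := hT.tendsto.eventually (Metric.ball_mem_nhds θ₀ hr)
  obtain ⟨hA, R, hR, hTR⟩ := hT
  set G₀ : ℕ × Ω → ℝ :=
    fun p => normSum (fun z => g 0 z θ₀ - ∫ y, g 0 y θ₀ ∂Q) p.1 fun i => Z i p.2
  set G₁ : ℕ × Ω → ℝ :=
    fun p => normSum (fun z => g 1 z θ₀ - ∫ y, g 1 y θ₀ ∂Q) p.1 fun i => Z i p.2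
  have hG₀ : BddInProb P G₀ := hZ.bddInProb_normSum_sub h0
  have hG₁ : BddInProb P G₁ := hZ.bddInProb_normSum_sub h1
  have hNm : BddInProb P fun p => sampleMean N p.1 fun i => Z i p.2 :=
    .of_tendsto (hZ.tendsto_sampleMean hN)
  have hx : BddInProb P fun p => A p + rate p * R p := hA.add (BddInProb.rate.mul hR)
  -- the Taylor remainder, multiplied by `n`
  set ρ : ℕ × Ω → ℝ := fun p => p.1 * (sampleMean (fun z => g 0 z (T p)) p.1 (fun i => Z i p.2)
    - (sampleMean (fun z => g 0 z θ₀) p.1 (fun i => Z i p.2)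
      + sampleMean (fun z => g 1 z θ₀) p.1 (fun i => Z i p.2) * (T p - θ₀))) with hρ
  have hρb : BddInProb P ρ := by
    refine (hNm.mul (hx.pow 2)).mono ?_
    filter_upwards [hball, hTR, eventually_pos_whp] with p hp hpR hn
    have htay := abs_sub_taylor_le (k := 2)
      (g := fun j t => sampleMean (fun z => g j z t) p.1 fun i => Z i p.2)
      (fun j hj t ht => hasDerivAt_sampleMean fun z => hd j hj z t ht)
      (fun t ht => abs_sampleMean_le fun z => hb z t ht) hp
    simp only [Finset.sum_range_succ, Finset.sum_range_zero, zero_add, pow_zero, mul_one, pow_one,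
      Nat.factorial_zero, Nat.factorial_one, Nat.cast_one, div_one] at htay
    have hTe : T p - θ₀ = rate p * (A p + rate p * R p) := by rw [hpR]; ring
    have hsq : (p.1 : ℝ) * |T p - θ₀| ^ 2 = (A p + rate p * R p) ^ 2 := by
      rw [sq_abs, hTe]
      linear_combination (A p + rate p * R p) ^ 2 * rate_sq_mul_natCast hn
    rw [hρ, abs_mul, Nat.abs_cast]
    refine (mul_le_mul_of_nonneg_left htay (Nat.cast_nonneg _)).trans ?_
    rw [mul_left_comm, hsq]
    exact le_abs_self _
  refine ⟨hG₀.add (hA.const_mul _),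
    fun p => (∫ z, g 1 z θ₀ ∂Q) * R p + G₁ p * (A p + rate p * R p) + ρ p,
    ((hR.const_mul _).add (hG₁.mul hx)).add hρb, ?_⟩
  filter_upwards [hTR, eventually_pos_whp] with p hpR hn
  have e0 := sampleMean_eq_add_rate_mul (fun z => g 0 z θ₀) (∫ z, g 0 z θ₀ ∂Q) hn fun i => Z i p.2
  have e1 := sampleMean_eq_add_rate_mul (fun z => g 1 z θ₀) (∫ z, g 1 z θ₀ ∂Q) hn fun i => Z i p.2
  change _ = _ + rate p * G₀ p at e0
  change _ = _ + rate p * G₁ p at e1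
  have eρ : rate p ^ 2 * ρ p = sampleMean (fun z => g 0 z (T p)) p.1 (fun i => Z i p.2)
    - (sampleMean (fun z => g 0 z θ₀) p.1 (fun i => Z i p.2)
      + sampleMean (fun z => g 1 z θ₀) p.1 (fun i => Z i p.2) * (T p - θ₀)) := by
    rw [hρ]
    simp only
    rw [← mul_assoc, rate_sq_mul_natCast hn, one_mul]
  rw [e0, e1] at eρ
  have hTe : T p - θ₀ = rate p * (A p + rate p * R p) := by rw [hpR]; ring
  rw [hTe] at eρ
  linear_combination -eρ

end Expansion

/-! ### Third-order expansion of the maximum likelihood estimator -/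

/-- Solving the cubic score equation by substitution: if
`I x = u + ε (v x + q₁ x² / 2) + ε² (w x² / 2 + q₂ x³ / 6) + ε³ c`, the solution agrees with its
formal expansion in `ε` up to `ε³` times a polynomial in all the quantities involved. Here `p₁`,
`p₂`, `p₃` are the divided remainders after the terms of order `0`, `1`, `2`. -/
theorem score_equation_expansion {I u v w q₁ q₂ ε x c p₁ p₂ p₃ : ℝ} (hI : I ≠ 0)
    (h : x * I = u + ε * (v * x + q₁ * x ^ 2 / 2) + ε ^ 2 * (w * x ^ 2 / 2 + q₂ * x ^ 3 / 6)
      + ε ^ 3 * c)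
    (h₁ : p₁ = I⁻¹ * (v * x + q₁ * x ^ 2 / 2 + ε * (w * x ^ 2 / 2 + q₂ * x ^ 3 / 6) + ε ^ 2 * c))
    (h₂ : p₂ = I⁻¹ * (v * p₁ + q₁ * (I⁻¹ * u) * p₁ + ε * q₁ * p₁ ^ 2 / 2
      + (w * x ^ 2 / 2 + q₂ * x ^ 3 / 6) + ε * c))
    (h₃ : p₃ = I⁻¹ * ((v + q₁ * (I⁻¹ * u)) * p₂ + q₁ * p₁ ^ 2 / 2
      + p₁ * (w * (2 * (I⁻¹ * u) + ε * p₁) / 2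
        + q₂ * (3 * (I⁻¹ * u) ^ 2 + 3 * (I⁻¹ * u) * ε * p₁ + ε ^ 2 * p₁ ^ 2) / 6) + c)) :
    x = I⁻¹ * u + ε * (1 / 2 * (I ^ 3)⁻¹ * q₁ * u ^ 2 + (I ^ 2)⁻¹ * u * v)
      + ε ^ 2 * (1 / 6 * (I ^ 4)⁻¹ * q₂ * u ^ 3 + 1 / 2 * (I ^ 5)⁻¹ * q₁ ^ 2 * u ^ 3
        + 3 / 2 * (I ^ 4)⁻¹ * q₁ * u ^ 2 * v + 1 / 2 * (I ^ 3)⁻¹ * u ^ 2 * w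
        + (I ^ 3)⁻¹ * u * v ^ 2)
      + ε ^ 3 * p₃ := by
  simp only [← inv_pow]
  have hI1 : I * I⁻¹ = 1 := mul_inv_cancel₀ hI
  generalize I⁻¹ = J at *
  have e1 : x = J * u + ε * p₁ := by
    rw [h₁]
    linear_combination J * h - x * hI1
  have e2 : p₁ = J * (v * (J * u) + q₁ * (J * u) ^ 2 / 2) + ε * p₂ := by
    have : x ^ 2 = (J * u) ^ 2 + 2 * (J * u) * (ε * p₁) + ε ^ 2 * p₁ ^ 2 := by rw [e1]; ring
    linear_combination h₁ - ε * h₂ + J * v * e1 + J * q₁ / 2 * this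
  have e3 : p₂ = J * ((v + q₁ * (J * u)) * (J * (v * (J * u) + q₁ * (J * u) ^ 2 / 2))
      + (w * (J * u) ^ 2 / 2 + q₂ * (J * u) ^ 3 / 6)) + ε * p₃ := by
    have s2 : x ^ 2 = (J * u) ^ 2 + 2 * (J * u) * (ε * p₁) + ε ^ 2 * p₁ ^ 2 := by rw [e1]; ring
    have s3 : x ^ 3 = (J * u) ^ 3 + 3 * (J * u) ^ 2 * (ε * p₁) + 3 * (J * u) * (ε * p₁) ^ 2
        + (ε * p₁) ^ 3 := by rw [e1]; ring
    linear_combination h₂ - ε * h₃ + J * (v + q₁ * (J * u)) * e2 + J * w / 2 * s2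
      + J * q₂ / 6 * s3
  rw [e1, e2, e3]
  ring

section MLE

variable {𝒵 Ω : Type*} [MeasurableSpace 𝒵] [MeasurableSpace Ω] {P : Measure Ω}
  {ν : Measure 𝒵} {f : 𝒵 → ℝ → ℝ} {Θ : Set ℝ} {θ₀ : ℝ}
  {Z : ℕ → Ω → 𝒵} {θhat : ℕ → Ω → ℝ}

theorem RegularModel.exists_ball (hreg : RegularModel ν f Θ θ₀) :
    ∃ r > 0, Metric.ball θ₀ r ⊆ _root_.interior Θ :=
  Metric.isOpen_iff.1 isOpen_interior θ₀ hreg.interior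

/-- The score equation. -/
theorem RegularModel.score_eq_zero (hreg : RegularModel ν f Θ θ₀) {n : ℕ} {x : ℕ → 𝒵} {t : ℝ}
    (ht : t ∈ _root_.interior Θ) (h : IsMLE f Θ n x t) :
    sampleMean (fun z => logDeriv f Θ 1 z t) n x = 0 := by
  have hd := hasDerivAt_sampleMean (n := n) (x := x) (g := logDeriv f Θ 0) (g' := logDeriv f Θ 1)
    fun z => hreg.hasDerivAt_logDeriv z ht (by norm_num)
  refine IsLocalMax.hasDerivAt_eq_zero ?_ hd
  filter_upwards [mem_interior_iff_mem_nhds.1 ht] with s hs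
  simpa [logDeriv] using h.2 hs

variable [IsProbabilityMeasure P]

theorem RegularModel.tendsto_mle (hreg : RegularModel ν f Θ θ₀)
    (hZ : IsIIDSample P (law ν f θ₀) Z) (hMLE : ∀ n ω, IsMLE f Θ n (fun i => Z i ω) (θhat n ω)) :
    Tendsto (fun p : ℕ × Ω => θhat p.1 p.2) (whp P) (𝓝 θ₀) := by
  have := hreg.isProbabilityMeasure_law
  obtain ⟨M, hM, hL⟩ := hreg.exists_envelope
  refine hZ.tendsto_argmax hreg.compact (h := fun z θ => Real.log (f z θ))
    (fun z => (hreg.smooth z).continuousOn)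
    (fun θ hθ => (hreg.measurable_density θ hθ).log) (hL.integrable (by norm_num))
    (fun z θ hθ => by simpa [logDeriv] using hM z θ hθ 0 (by norm_num)) hreg.mem
    (fun θ hθ hne => hreg.integral_log_lt hθ hne) hMLE

omit [IsProbabilityMeasure P] [MeasurableSpace Ω] in
theorem rate_mul_sqrt {p : ℕ × Ω} (hp : 0 < p.1) : rate p * √(p.1 : ℝ) = 1 :=
  inv_mul_cancel₀ (sqrt_natCast_pos hp).ne'

theorem RegularModel.bddInProb_U (hreg : RegularModel ν f Θ θ₀)
    (hZ : IsIIDSample P (law ν f θ₀) Z) :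
    BddInProb P fun p => U f Θ θ₀ p.1 fun i => Z i p.2 :=
  hZ.bddInProb_normSum (hreg.memLp_two_logDeriv (m := 1) (by norm_num) hreg.mem) hreg.integral_ell

theorem RegularModel.bddInProb_V (hreg : RegularModel ν f Θ θ₀)
    (hZ : IsIIDSample P (law ν f θ₀) Z) :
    BddInProb P fun p => V ν f Θ θ₀ p.1 fun i => Z i p.2 :=
  hZ.bddInProb_normSum_sub (hreg.memLp_two_logDeriv (m := 2) (by norm_num) hreg.mem)

theorem RegularModel.bddInProb_W (hreg : RegularModel ν f Θ θ₀)
    (hZ : IsIIDSample P (law ν f θ₀) Z) :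
    BddInProb P fun p => W ν f Θ θ₀ p.1 fun i => Z i p.2 :=
  hZ.bddInProb_normSum_sub (hreg.memLp_two_logDeriv (m := 3) (by norm_num) hreg.mem)

omit [MeasurableSpace 𝒵] [MeasurableSpace Ω] in
theorem sampleMean_ell_eq {p : ℕ × Ω} (hp : 0 < p.1) :
    sampleMean (fun z => logDeriv f Θ 1 z θ₀) p.1 (fun i => Z i p.2)
      = rate p * U f Θ θ₀ p.1 fun i => Z i p.2 := by
  have h := sampleMean_eq_add_rate_mul (fun z => logDeriv f Θ 1 z θ₀) 0 hp fun i => Z i p.2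
  simp only [zero_add, sub_zero] at h
  exact h

omit [MeasurableSpace Ω] in
theorem sampleMean_ell1_eq {p : ℕ × Ω} (hp : 0 < p.1) :
    sampleMean (fun z => logDeriv f Θ 2 z θ₀) p.1 (fun i => Z i p.2)
      = -info ν f Θ θ₀ + rate p * V ν f Θ θ₀ p.1 fun i => Z i p.2 := by
  rw [info, neg_neg]
  exact sampleMean_eq_add_rate_mul (fun z => logDeriv f Θ 2 z θ₀) _ hp fun i => Z i p.2

/-- Root-`n` consistency, from the first-order expansion of the score: with probability tending to
one its slope is bounded away from zero. -/
theorem RegularModel.bddInProb_sqrt_mul_mle_sub (hreg : RegularModel ν f Θ θ₀)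
    (hinfo : 0 < info ν f Θ θ₀) (hZ : IsIIDSample P (law ν f θ₀) Z)
    (hMLE : ∀ n ω, IsMLE f Θ n (fun i => Z i ω) (θhat n ω)) :
    BddInProb P fun p => √(p.1 : ℝ) * (θhat p.1 p.2 - θ₀) := by
  have := hreg.isProbabilityMeasure_law
  obtain ⟨M, hM, hL⟩ := hreg.exists_envelope
  obtain ⟨r, hr, hball⟩ := hreg.exists_ball
  have hT := hreg.tendsto_mle hZ hMLE
  have hU := hreg.bddInProb_U hZ
  have hV := hreg.bddInProb_V hZ
  set I := info ν f Θ θ₀ with hI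
  have hMm := hZ.tendsto_sampleMean (hL.mono_exponent (p := 2) (by norm_num))
  have hsmall₁ : Tendsto (fun p => |rate p * V ν f Θ θ₀ p.1 fun i => Z i p.2|) (whp P) (𝓝 0) := by
    simpa using hV.tendsto_rate_mul.abs
  have hsmall₂ : Tendsto (fun p : ℕ × Ω => sampleMean M p.1 (fun i => Z i p.2)
      * |θhat p.1 p.2 - θ₀|) (whp P) (𝓝 0) := by
    simpa using hMm.mul (hT.sub_const θ₀).abs
  refine (hU.const_mul (2 / I)).mono ?_
  filter_upwards [hT.eventually (Metric.ball_mem_nhds θ₀ hr), eventually_pos_whp,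
    hsmall₁.eventually_lt_const (show 0 < I / 4 by positivity),
    hsmall₂.eventually_lt_const (show 0 < I / 4 by positivity)] with p hp hn h1 h2
  have htay := abs_sub_taylor_le (k := 2)
    (g := fun j t => sampleMean (fun z => logDeriv f Θ (1 + j) z t) p.1 fun i => Z i p.2)
    (fun j hj t ht => hasDerivAt_sampleMean fun z =>
      hreg.hasDerivAt_logDeriv z (hball ht) (by omega))
    (fun t ht => abs_sampleMean_le fun z => hM z t (interior_subset (hball ht)) 3 (by norm_num)) hp
  simp only [Finset.sum_range_succ, Finset.sum_range_zero, zero_add, pow_zero, mul_one, pow_one,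
    Nat.factorial_zero, Nat.factorial_one, Nat.cast_one, div_one, add_zero, one_add_one_eq_two]
    at htay
  rw [hreg.score_eq_zero (hball hp) (hMLE p.1 p.2), sampleMean_ell_eq hn,
    sampleMean_ell1_eq (ν := ν) hn, ← hI] at htay
  set u := U f Θ θ₀ p.1 fun i => Z i p.2
  set v := V ν f Θ θ₀ p.1 fun i => Z i p.2
  set δ := θhat p.1 p.2 - θ₀
  have hrate : 0 < rate p := inv_pos.2 (sqrt_natCast_pos hn)
  have hδ : I * |δ| ≤ rate p * |u| + |rate p * v| * |δ|
      + sampleMean M p.1 (fun i => Z i p.2) * |δ| * |δ| := by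
    have e : I * δ = rate p * u + rate p * v * δ
        + (0 - (rate p * u + (-I + rate p * v) * δ)) := by ring
    rw [← abs_of_pos hinfo, ← abs_mul, e, ← abs_of_pos hrate, ← abs_mul, abs_of_pos hrate,
      ← abs_mul (rate p * v)]
    refine (abs_add_le _ _).trans (add_le_add (abs_add_le _ _) (htay.trans_eq ?_))
    ring
  have hδ' : I * |δ| ≤ 2 * (rate p * |u|) := by
    nlinarith [mul_le_mul_of_nonneg_right h1.le (abs_nonneg δ),
      mul_le_mul_of_nonneg_right h2.le (abs_nonneg δ)]
  have hsq := sqrt_natCast_pos hn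
  rw [abs_mul, abs_of_pos hsq, abs_mul, abs_of_pos (show 0 < 2 / I by positivity),
    div_mul_eq_mul_div, le_div_iff₀ hinfo]
  have h3 := mul_le_mul_of_nonneg_left hδ' hsq.le
  calc √(p.1 : ℝ) * |δ| * I = √(p.1 : ℝ) * (I * |δ|) := by ring
    _ ≤ √(p.1 : ℝ) * (2 * (rate p * |u|)) := h3
    _ = 2 * |u| * (rate p * √(p.1 : ℝ)) := by ring
    _ = 2 * |u| := by rw [rate_mul_sqrt hn, mul_one]

/-- `√n (θhat - θ₀) = A₁ + n^{-1/2} A₂ + n⁻¹ A₃ + O_p(n^{-3/2})`. -/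
theorem RegularModel.mle_expansion (hreg : RegularModel ν f Θ θ₀)
    (hinfo : 0 < info ν f Θ θ₀) (hZ : IsIIDSample P (law ν f θ₀) Z)
    (hMLE : ∀ n ω, IsMLE f Θ n (fun i => Z i ω) (θhat n ω)) :
    ∃ R : ℕ × Ω → ℝ, BddInProb P R ∧ ∀ᶠ p in whp P, √(p.1 : ℝ) * (θhat p.1 p.2 - θ₀)
      = A1 ν f Θ θ₀ p.1 (fun i => Z i p.2) + rate p * A2 ν f Θ θ₀ p.1 (fun i => Z i p.2)
        + rate p ^ 2 * A3 ν f Θ θ₀ p.1 (fun i => Z i p.2) + rate p ^ 3 * R p := by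
  have := hreg.isProbabilityMeasure_law
  obtain ⟨M, hM, hL⟩ := hreg.exists_envelope
  obtain ⟨r, hr, hball⟩ := hreg.exists_ball
  have hT := hreg.tendsto_mle hZ hMLE
  have hU := hreg.bddInProb_U hZ
  have hV := hreg.bddInProb_V hZ
  have hW := hreg.bddInProb_W hZ
  have hx := hreg.bddInProb_sqrt_mul_mle_sub hinfo hZ hMLE
  have hMm : BddInProb P fun p => sampleMean M p.1 fun i => Z i p.2 :=
    .of_tendsto (hZ.tendsto_sampleMean (hL.mono_exponent (p := 2) (by norm_num)))
  have hY := hZ.bddInProb_normSum_sub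
    (hreg.memLp_two_logDeriv (m := 4) (by norm_num) hreg.mem)
  set u : ℕ × Ω → ℝ := fun p => U f Θ θ₀ p.1 fun i => Z i p.2 with hu
  set v : ℕ × Ω → ℝ := fun p => V ν f Θ θ₀ p.1 fun i => Z i p.2 with hv
  set w : ℕ × Ω → ℝ := fun p => W ν f Θ θ₀ p.1 fun i => Z i p.2 with hw
  set x : ℕ × Ω → ℝ := fun p => √(p.1 : ℝ) * (θhat p.1 p.2 - θ₀) with hxdef
  set y : ℕ × Ω → ℝ := fun p => normSum (fun z => logDeriv f Θ 4 z θ₀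
    - ∫ z, logDeriv f Θ 4 z θ₀ ∂(law ν f θ₀)) p.1 fun i => Z i p.2 with hy
  set I := info ν f Θ θ₀ with hI
  set q₁ := Q1 ν f Θ θ₀ with hq₁
  set q₂ := Q2 ν f Θ θ₀ with hq₂
  -- the Taylor remainder of the score, multiplied by `n ^ 2`
  set ρ : ℕ × Ω → ℝ := fun p => -((p.1 : ℝ) ^ 2 * (rate p * u p
    + (-I + rate p * v p) * (θhat p.1 p.2 - θ₀)
    + (q₁ + rate p * w p) * (θhat p.1 p.2 - θ₀) ^ 2 / 2
    + (q₂ + rate p * y p) * (θhat p.1 p.2 - θ₀) ^ 3 / 6)) with hρ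
  have hρb : BddInProb P ρ := by
    refine (hMm.mul (hx.pow 4)).mono ?_
    filter_upwards [hT.eventually (Metric.ball_mem_nhds θ₀ hr), eventually_pos_whp] with p hp hn
    have htay := abs_sub_taylor_le (k := 4)
      (g := fun j t => sampleMean (fun z => logDeriv f Θ (1 + j) z t) p.1 fun i => Z i p.2)
      (fun j hj t ht => hasDerivAt_sampleMean fun z =>
        hreg.hasDerivAt_logDeriv z (hball ht) (by omega))
      (fun t ht => abs_sampleMean_le fun z => hM z t (interior_subset (hball ht)) 5 (by norm_num))
      hp
    have e3 : sampleMean (fun z => logDeriv f Θ 3 z θ₀) p.1 (fun i => Z i p.2)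
        = q₁ + rate p * w p :=
      sampleMean_eq_add_rate_mul (fun z => logDeriv f Θ 3 z θ₀) _ hn fun i => Z i p.2
    have e4 : sampleMean (fun z => logDeriv f Θ 4 z θ₀) p.1 (fun i => Z i p.2)
        = q₂ + rate p * y p :=
      sampleMean_eq_add_rate_mul (fun z => logDeriv f Θ 4 z θ₀) _ hn fun i => Z i p.2
    simp only [Finset.sum_range_succ, Finset.sum_range_zero, zero_add, pow_zero, mul_one, pow_one,
      Nat.factorial_zero, Nat.factorial_one, show Nat.factorial 2 = 2 from rfl,
      show Nat.factorial 3 = 6 from rfl, Nat.cast_one, div_one, add_zero, Nat.reduceAdd,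
      Nat.cast_ofNat] at htay
    rw [hreg.score_eq_zero (hball hp) (hMLE p.1 p.2), sampleMean_ell_eq hn,
      sampleMean_ell1_eq (ν := ν) hn, e3, e4, zero_sub] at htay
    have hx4 : (p.1 : ℝ) ^ 2 * |θhat p.1 p.2 - θ₀| ^ 4 = x p ^ 4 := by
      have hs : √(p.1 : ℝ) ^ 2 = p.1 := Real.sq_sqrt (Nat.cast_nonneg _)
      rw [show |θhat p.1 p.2 - θ₀| ^ 4 = (|θhat p.1 p.2 - θ₀| ^ 2) ^ 2 by ring, sq_abs, hxdef,
        ← hs]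
      ring
    simp only [hρ]
    rw [← mul_neg, abs_mul, abs_of_nonneg (sq_nonneg (p.1 : ℝ))]
    refine (mul_le_mul_of_nonneg_left htay (sq_nonneg _)).trans ?_
    rw [mul_left_comm, hx4]
    exact le_abs_self _
  have hε : BddInProb P (rate (Ω := Ω)) := BddInProb.rate
  have hx₀ := hU.const_mul I⁻¹
  have hc : BddInProb P fun p => y p * x p ^ 3 / 6 + ρ p := by
    simpa only [div_eq_mul_inv] using ((hY.mul (hx.pow 3)).mul (.const 6⁻¹)).add hρb
  have hb : BddInProb P fun p => w p * x p ^ 2 / 2 + q₂ * x p ^ 3 / 6 := by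
    simpa only [div_eq_mul_inv] using
      ((hW.mul (hx.pow 2)).mul (.const 2⁻¹)).add (((hx.pow 3).const_mul q₂).mul (.const 6⁻¹))
  obtain ⟨p₁, hp₁, hp₁e⟩ : ∃ p₁ : ℕ × Ω → ℝ, BddInProb P p₁ ∧ ∀ p, p₁ p =
      I⁻¹ * (v p * x p + q₁ * x p ^ 2 / 2 + rate p * (w p * x p ^ 2 / 2 + q₂ * x p ^ 3 / 6)
        + rate p ^ 2 * (y p * x p ^ 3 / 6 + ρ p)) := by
    refine ⟨_, ?_, fun _ => rfl⟩
    refine ((((hV.mul hx).add ?_).add (hε.mul hb)).add ((hε.pow 2).mul hc)).const_mul I⁻¹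
    simpa only [div_eq_mul_inv] using ((hx.pow 2).const_mul q₁).mul (.const 2⁻¹)
  obtain ⟨p₂, hp₂, hp₂e⟩ : ∃ p₂ : ℕ × Ω → ℝ, BddInProb P p₂ ∧ ∀ p, p₂ p =
      I⁻¹ * (v p * p₁ p + q₁ * (I⁻¹ * u p) * p₁ p + rate p * q₁ * p₁ p ^ 2 / 2
        + (w p * x p ^ 2 / 2 + q₂ * x p ^ 3 / 6) + rate p * (y p * x p ^ 3 / 6 + ρ p)) := by
    refine ⟨_, ?_, fun _ => rfl⟩
    refine (((((hV.mul hp₁).add ((hx₀.const_mul q₁).mul hp₁)).add ?_).add hb).add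
      (hε.mul hc)).const_mul I⁻¹
    simpa only [div_eq_mul_inv] using ((hε.mul (.const q₁)).mul (hp₁.pow 2)).mul (.const 2⁻¹)
  refine ⟨fun p => I⁻¹ * ((v p + q₁ * (I⁻¹ * u p)) * p₂ p + q₁ * p₁ p ^ 2 / 2
      + p₁ p * (w p * (2 * (I⁻¹ * u p) + rate p * p₁ p) / 2
        + q₂ * (3 * (I⁻¹ * u p) ^ 2 + 3 * (I⁻¹ * u p) * rate p * p₁ p
          + rate p ^ 2 * p₁ p ^ 2) / 6) + (y p * x p ^ 3 / 6 + ρ p)), ?_, ?_⟩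
  · refine (((((hV.add (hx₀.const_mul q₁)).mul hp₂).add ?_).add (hp₁.mul ?_)).add hc).const_mul _
    · simpa only [div_eq_mul_inv] using ((hp₁.pow 2).const_mul q₁).mul (.const 2⁻¹)
    · refine BddInProb.add ?_ ?_
      · simpa only [div_eq_mul_inv] using
          (hW.mul ((hx₀.const_mul 2).add (hε.mul hp₁))).mul (.const 2⁻¹)
      · simpa only [div_eq_mul_inv] using ((((((hx₀.pow 2).const_mul 3).add
          (((hx₀.const_mul 3).mul hε).mul hp₁)).add
            ((hε.pow 2).mul (hp₁.pow 2))).const_mul q₂).mul (.const 6⁻¹))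
  · filter_upwards [eventually_pos_whp] with p hn
    refine score_equation_expansion hinfo.ne' (c := y p * x p ^ 3 / 6 + ρ p) ?_
      (hp₁e p) (hp₂e p) rfl
    have hs := rate_mul_sqrt hn
    have hδ : θhat p.1 p.2 - θ₀ = rate p * x p := by
      rw [hxdef]
      linear_combination (-(θhat p.1 p.2 - θ₀)) * hs
    have hρp : rate p ^ 4 * ρ p = -(rate p * u p + (-I + rate p * v p) * (rate p * x p)
        + (q₁ + rate p * w p) * (rate p * x p) ^ 2 / 2
        + (q₂ + rate p * y p) * (rate p * x p) ^ 3 / 6) := by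
      have hn2 : rate p ^ 4 * (p.1 : ℝ) ^ 2 = 1 := by
        rw [show rate p ^ 4 * (p.1 : ℝ) ^ 2 = (rate p ^ 2 * (p.1 : ℝ)) ^ 2 by ring,
          rate_sq_mul_natCast hn, one_pow]
      rw [hρ]
      simp only [hδ]
      linear_combination (-(rate p * u p + (-I + rate p * v p) * (rate p * x p)
        + (q₁ + rate p * w p) * (rate p * x p) ^ 2 / 2
        + (q₂ + rate p * y p) * (rate p * x p) ^ 3 / 6)) * hn2
    have hrate : rate p ≠ 0 := (inv_pos.2 (sqrt_natCast_pos hn)).ne'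
    refine mul_left_cancel₀ hrate ?_
    linear_combination -hρp

end MLE

/-! ### The bias estimate -/

section Bias

variable {𝒵 Ω : Type*} [MeasurableSpace 𝒵] [MeasurableSpace Ω] {P : Measure Ω}
  {ν : Measure 𝒵} {f : 𝒵 → ℝ → ℝ} {Θ : Set ℝ} {θ₀ : ℝ}
  {Z : ℕ → Ω → 𝒵} {θhat : ℕ → Ω → ℝ} [IsProbabilityMeasure P]

/-- The second-order term of the expansion of the estimator contributes at order `n⁻¹` only. -/
theorem RegularModel.hasExpansion_mle (hreg : RegularModel ν f Θ θ₀)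
    (hinfo : 0 < info ν f Θ θ₀) (hZ : IsIIDSample P (law ν f θ₀) Z)
    (hMLE : ∀ n ω, IsMLE f Θ n (fun i => Z i ω) (θhat n ω)) :
    HasExpansion P (fun p => θhat p.1 p.2) θ₀ fun p => A1 ν f Θ θ₀ p.1 fun i => Z i p.2 := by
  obtain ⟨R, hR, h⟩ := hreg.mle_expansion hinfo hZ hMLE
  have hU := hreg.bddInProb_U hZ
  have hV := hreg.bddInProb_V hZ
  have hW := hreg.bddInProb_W hZ
  have hε : BddInProb P (rate (Ω := Ω)) := BddInProb.rate
  have hA2 : BddInProb P fun p => A2 ν f Θ θ₀ p.1 fun i => Z i p.2 :=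
    ((hU.pow 2).const_mul _).add ((hU.const_mul _).mul hV)
  have hA3 : BddInProb P fun p => A3 ν f Θ θ₀ p.1 fun i => Z i p.2 :=
    (((((hU.pow 3).const_mul _).add ((hU.pow 3).const_mul _)).add
      (((hU.pow 2).const_mul _).mul hV)).add (((hU.pow 2).const_mul _).mul hW)).add
        ((hU.const_mul _).mul (hV.pow 2))
  refine ⟨hU.const_mul _, fun p => A2 ν f Θ θ₀ p.1 (fun i => Z i p.2)
    + rate p * A3 ν f Θ θ₀ p.1 (fun i => Z i p.2) + rate p ^ 2 * R p,
    (hA2.add (hε.mul hA3)).add ((hε.pow 2).mul hR), ?_⟩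
  filter_upwards [h, eventually_pos_whp] with p hp hn
  linear_combination rate p * hp - (θhat p.1 p.2 - θ₀) * rate_mul_sqrt hn

section NormSum

variable {n : ℕ} {x : ℕ → 𝒵}

omit [MeasurableSpace 𝒵] in
theorem normSum_add (g h : 𝒵 → ℝ) :
    normSum (fun z => g z + h z) n x = normSum g n x + normSum h n x := by
  simp only [normSum, Finset.sum_add_distrib, add_div]

omit [MeasurableSpace 𝒵] in
theorem normSum_const_mul (c : ℝ) (g : 𝒵 → ℝ) :
    normSum (fun z => c * g z) n x = c * normSum g n x := by
  simp only [normSum, ← Finset.mul_sum, mul_div_assoc]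

end NormSum

theorem RegularModel.integrable_logDeriv_mul (hreg : RegularModel ν f Θ θ₀) {m k : ℕ} (hm : m ≤ 7)
    (hk : k ≤ 7) :
    Integrable (fun z => logDeriv f Θ m z θ₀ * logDeriv f Θ k z θ₀) (law ν f θ₀) := by
  have := hreg.isProbabilityMeasure_law
  exact (hreg.memLp_logDeriv_mul hm hk hreg.mem).integrable one_le_two

/-- As the score has mean zero, centring the other factor does not change the covariance. -/
theorem RegularModel.integral_ell_mul_sub (hreg : RegularModel ν f Θ θ₀) {m : ℕ} (hm : m ≤ 7)
    (a : ℝ) :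
    ∫ z, ell f Θ z θ₀ * (logDeriv f Θ m z θ₀ - a) ∂(law ν f θ₀)
      = ∫ z, ell f Θ z θ₀ * logDeriv f Θ m z θ₀ ∂(law ν f θ₀) := by
  have := hreg.isProbabilityMeasure_law
  have h1 : Integrable (fun z => ell f Θ z θ₀ * logDeriv f Θ m z θ₀) (law ν f θ₀) :=
    hreg.integrable_logDeriv_mul (by norm_num) hm
  have h2 : Integrable (fun z => ell f Θ z θ₀) (law ν f θ₀) :=
    (hreg.memLp_two_logDeriv (m := 1) (by norm_num) hreg.mem).integrable one_le_two
  simp only [mul_sub]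
  rw [integral_sub h1 (h2.mul_const a), integral_mul_const, hreg.integral_ell, zero_mul, sub_zero]

/-- Sample averages of derivatives of the log-density at the maximum likelihood estimator. -/
theorem RegularModel.hasExpansion_sampleMean_logDeriv (hreg : RegularModel ν f Θ θ₀)
    (hinfo : 0 < info ν f Θ θ₀) (hZ : IsIIDSample P (law ν f θ₀) Z)
    (hMLE : ∀ n ω, IsMLE f Θ n (fun i => Z i ω) (θhat n ω)) {m : ℕ} (hm : m ≤ 5) :
    HasExpansion P
      (fun p => sampleMean (fun z => logDeriv f Θ m z (θhat p.1 p.2)) p.1 fun i => Z i p.2)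
      (∫ z, logDeriv f Θ m z θ₀ ∂(law ν f θ₀))
      fun p => normSum (fun z => logDeriv f Θ m z θ₀ - ∫ y, logDeriv f Θ m y θ₀ ∂(law ν f θ₀)) p.1
          (fun i => Z i p.2)
        + (∫ z, logDeriv f Θ (m + 1) z θ₀ ∂(law ν f θ₀))
          * A1 ν f Θ θ₀ p.1 fun i => Z i p.2 := by
  have := hreg.isProbabilityMeasure_law
  obtain ⟨M, hM, hL⟩ := hreg.exists_envelope
  obtain ⟨r, hr, hball⟩ := hreg.exists_ball
  exact HasExpansion.sampleMean_comp hZ (g := fun j => logDeriv f Θ (m + j)) (N := M) hr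
    (fun j hj z t ht => hreg.hasDerivAt_logDeriv z (hball ht) (by omega))
    (fun z t ht => hM z t (interior_subset (hball ht)) (m + 2) (by omega))
    (hL.mono_exponent (by norm_num))
    (hreg.memLp_two_logDeriv (by omega) hreg.mem) (hreg.memLp_two_logDeriv (by omega) hreg.mem)
    (hreg.hasExpansion_mle hinfo hZ hMLE)

/-- Sample averages of products of derivatives of the log-density at the maximum likelihood
estimator. -/
theorem RegularModel.hasExpansion_sampleMean_mul (hreg : RegularModel ν f Θ θ₀)
    (hinfo : 0 < info ν f Θ θ₀) (hZ : IsIIDSample P (law ν f θ₀) Z)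
    (hMLE : ∀ n ω, IsMLE f Θ n (fun i => Z i ω) (θhat n ω)) {m k : ℕ} (hm : m ≤ 5)
    (hk : k ≤ 5) :
    HasExpansion P
      (fun p => sampleMean (fun z => logDeriv f Θ m z (θhat p.1 p.2)
        * logDeriv f Θ k z (θhat p.1 p.2)) p.1 fun i => Z i p.2)
      (∫ z, logDeriv f Θ m z θ₀ * logDeriv f Θ k z θ₀ ∂(law ν f θ₀))
      fun p => normSum (fun z => logDeriv f Θ m z θ₀ * logDeriv f Θ k z θ₀
          - ∫ y, logDeriv f Θ m y θ₀ * logDeriv f Θ k y θ₀ ∂(law ν f θ₀)) p.1 (fun i => Z i p.2)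
        + (∫ z, (logDeriv f Θ (m + 1) z θ₀ * logDeriv f Θ k z θ₀
            + logDeriv f Θ m z θ₀ * logDeriv f Θ (k + 1) z θ₀) ∂(law ν f θ₀))
          * A1 ν f Θ θ₀ p.1 fun i => Z i p.2 := by
  have := hreg.isProbabilityMeasure_law
  obtain ⟨M, hM, hL⟩ := hreg.exists_envelope
  obtain ⟨r, hr, hball⟩ := hreg.exists_ball
  have hM2 : MemLp (fun z => 4 * (M z * M z)) 2 (law ν f θ₀) := by
    have := holderTriple_four_four_two
    have h : MemLp (fun z => M z * M z) 2 (law ν f θ₀) := hL.mul' hL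
    exact h.const_mul 4
  set D : ℕ → 𝒵 → ℝ → ℝ := logDeriv f Θ with hD
  have hd : ∀ j < 7, ∀ z, ∀ t ∈ Metric.ball θ₀ r, HasDerivAt (D j z) (D (j + 1) z t) t :=
    fun j hj z t ht => hreg.hasDerivAt_logDeriv z (hball ht) hj
  exact HasExpansion.sampleMean_comp hZ (N := fun z => 4 * (M z * M z)) hr
    (g := fun j z t => match j with
      | 0 => D m z t * D k z t
      | 1 => D (m + 1) z t * D k z t + D m z t * D (k + 1) z t
      | _ => D (m + 2) z t * D k z t + D (m + 1) z t * D (k + 1) z t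
          + (D (m + 1) z t * D (k + 1) z t + D m z t * D (k + 2) z t))
    (fun j hj z t ht => by
      interval_cases j
      · exact (hd m (by omega) z t ht).mul (hd k (by omega) z t ht)
      · exact ((hd (m + 1) (by omega) z t ht).mul (hd k (by omega) z t ht)).add
          ((hd m (by omega) z t ht).mul (hd (k + 1) (by omega) z t ht)))
    (fun z t ht => by
      have hb : ∀ i ≤ 7, ∀ j ≤ 7, |D i z t * D j z t| ≤ M z * M z := fun i hi j hj => by
        have ht' := interior_subset (hball ht)
        rw [abs_mul]
        exact mul_le_mul (hM z t ht' i hi) (hM z t ht' j hj) (abs_nonneg _)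
          ((abs_nonneg _).trans (hM z t ht' i hi))
      have h1 := hb (m + 2) (by omega) k (by omega)
      have h2 := hb (m + 1) (by omega) (k + 1) (by omega)
      have h3 := hb m (by omega) (k + 2) (by omega)
      refine (abs_add_le _ _).trans ?_
      have h4 := abs_add_le (D (m + 2) z t * D k z t) (D (m + 1) z t * D (k + 1) z t)
      have h5 := abs_add_le (D (m + 1) z t * D (k + 1) z t) (D m z t * D (k + 2) z t)
      linarith)
    hM2 (hreg.memLp_logDeriv_mul (by omega) (by omega) hreg.mem)
    ((hreg.memLp_logDeriv_mul (by omega) (by omega) hreg.mem).add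
      (hreg.memLp_logDeriv_mul (by omega) (by omega) hreg.mem))
    (hreg.hasExpansion_mle hinfo hZ hMLE)

/-- The influence function of the bias estimate, found by the delta method. -/
theorem RegularModel.hasExpansion_biasEst (hreg : RegularModel ν f Θ θ₀)
    (hinfo : 0 < info ν f Θ θ₀)
    (hswap : ∫ z, iteratedDerivWithin 2 (fun θ => f z θ) Θ θ₀ ∂ν = 0)
    (hZ : IsIIDSample P (law ν f θ₀) Z)
    (hMLE : ∀ n ω, IsMLE f Θ n (fun i => Z i ω) (θhat n ω)) :
    HasExpansion P (fun p => biasEst f Θ p.1 (fun i => Z i p.2) (θhat p.1 p.2))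
      (bias ν f Θ θ₀) fun p => BB ν f Θ θ₀ p.1 fun i => Z i p.2 := by
  have hI : info ν f Θ θ₀ ≠ 0 := hinfo.ne'
  have hell1 : ∫ z, logDeriv f Θ 2 z θ₀ ∂(law ν f θ₀) = -info ν f Θ θ₀ := by
    rw [info, neg_neg]; rfl
  have hs' : ∫ z, (logDeriv f Θ 2 z θ₀ * logDeriv f Θ 1 z θ₀
      + logDeriv f Θ 1 z θ₀ * logDeriv f Θ 2 z θ₀) ∂(law ν f θ₀)
      = 2 * ∫ z, ell f Θ z θ₀ * ell1 f Θ z θ₀ ∂(law ν f θ₀) := by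
    rw [← integral_const_mul]
    refine integral_congr_ae (ae_of_all _ fun z => ?_)
    simp only [ell, ell1]
    ring
  have hc' : ∫ z, (logDeriv f Θ 2 z θ₀ * logDeriv f Θ 2 z θ₀
      + logDeriv f Θ 1 z θ₀ * logDeriv f Θ 3 z θ₀) ∂(law ν f θ₀)
      = E ν f θ₀ (fun z => ell1 f Θ z θ₀ ^ 2) + ∫ z, ell f Θ z θ₀ * ell2 f Θ z θ₀ ∂(law ν f θ₀) := by
    rw [integral_add (hreg.integrable_logDeriv_mul (by norm_num) (by norm_num))
      (hreg.integrable_logDeriv_mul (by norm_num) (by norm_num))]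
    simp only [E, ell, ell1, ell2, sq]
  have hUV : E ν f θ₀ (fun y => Ui f Θ θ₀ y * Vi ν f Θ θ₀ y)
      = ∫ z, ell f Θ z θ₀ * ell1 f Θ z θ₀ ∂(law ν f θ₀) :=
    hreg.integral_ell_mul_sub (by norm_num) _
  have hUW : E ν f θ₀ (fun y => Ui f Θ θ₀ y * Wi ν f Θ θ₀ y)
      = ∫ z, ell f Θ z θ₀ * ell2 f Θ z θ₀ ∂(law ν f θ₀) :=
    hreg.integral_ell_mul_sub (by norm_num) _
  -- the four sample averages that enter the estimate, as defined in terms of `ell`, `ell1`, `ell2`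
  have hh : HasExpansion P
      (fun p => sampleMean (fun z => ell1 f Θ z (θhat p.1 p.2)) p.1 fun i => Z i p.2)
      (-info ν f Θ θ₀) fun p => V ν f Θ θ₀ p.1 (fun i => Z i p.2)
        + Q1 ν f Θ θ₀ * A1 ν f Θ θ₀ p.1 fun i => Z i p.2 := by
    rw [← hell1]
    exact hreg.hasExpansion_sampleMean_logDeriv hinfo hZ hMLE (m := 2) (by norm_num)
  have hq : HasExpansion P
      (fun p => sampleMean (fun z => ell2 f Θ z (θhat p.1 p.2)) p.1 fun i => Z i p.2)
      (Q1 ν f Θ θ₀) fun p => W ν f Θ θ₀ p.1 (fun i => Z i p.2)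
        + Q2 ν f Θ θ₀ * A1 ν f Θ θ₀ p.1 fun i => Z i p.2 :=
    hreg.hasExpansion_sampleMean_logDeriv hinfo hZ hMLE (m := 3) (by norm_num)
  have hs : HasExpansion P
      (fun p => sampleMean (fun z => ell f Θ z (θhat p.1 p.2) ^ 2) p.1 fun i => Z i p.2)
      (info ν f Θ θ₀) fun p => normSum (fun z => ell f Θ z θ₀ ^ 2
          - E ν f θ₀ (fun y => ell f Θ y θ₀ ^ 2)) p.1 (fun i => Z i p.2)
        + (2 * ∫ z, ell f Θ z θ₀ * ell1 f Θ z θ₀ ∂(law ν f θ₀))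
          * A1 ν f Θ θ₀ p.1 fun i => Z i p.2 := by
    have h := hreg.hasExpansion_sampleMean_mul hinfo hZ hMLE (m := 1) (k := 1) (by norm_num)
      (by norm_num)
    rw [hs'] at h
    simp only [← sq] at h
    rw [← hreg.integral_ell_sq hswap]
    exact h
  have hc : HasExpansion P
      (fun p => sampleMean (fun z => ell f Θ z (θhat p.1 p.2) * ell1 f Θ z (θhat p.1 p.2)) p.1
        fun i => Z i p.2)
      (∫ z, ell f Θ z θ₀ * ell1 f Θ z θ₀ ∂(law ν f θ₀)) fun p =>
        normSum (fun z => ell f Θ z θ₀ * ell1 f Θ z θ₀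
          - E ν f θ₀ (fun y => ell f Θ y θ₀ * ell1 f Θ y θ₀)) p.1 (fun i => Z i p.2)
        + (E ν f θ₀ (fun z => ell1 f Θ z θ₀ ^ 2)
            + ∫ z, ell f Θ z θ₀ * ell2 f Θ z θ₀ ∂(law ν f θ₀))
          * A1 ν f Θ θ₀ p.1 fun i => Z i p.2 := by
    rw [← hc']
    exact hreg.hasExpansion_sampleMean_mul hinfo hZ hMLE (m := 1) (k := 2) (by norm_num)
      (by norm_num)
  have hk := hh.inv (neg_ne_zero.2 hI)
  have hfinal := (((hq.mul hs).mul ((hk.mul hk).mul hk)).const_mul (-(1 / 2))).add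
    (hc.mul (hk.mul hk))
  convert hfinal using 1
  · funext p
    simp only [biasEst]
    ring
  · rw [bias]
    simp only [E]
    rw [hreg.integral_ell_sq hswap, Q1, E]
    field_simp
  · funext p
    rw [BB]
    change normSum (fun z => BBi ν f Θ θ₀ z) _ _ = _
    simp only [BBi, normSum_add, normSum_const_mul, hUV, hUW]
    rw [A1, U, V, W]
    field_simp
    ring

end Bias

end BiasMLE

theorem mainTheorem7 {𝒵 Ω : Type*} [MeasurableSpace 𝒵] [MeasurableSpace Ω]
    (P : Measure Ω) [IsProbabilityMeasure P]
    (ν : Measure 𝒵) (f : 𝒵 → ℝ → ℝ) (Θ : Set ℝ) (θ₀ : ℝ)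
    (hreg : BiasMLE.RegularModel ν f Θ θ₀)
    (hinfo : 0 < BiasMLE.info ν f Θ θ₀)
    -- `∫ f(z, θ) dν(z) = 1` may be differentiated twice under the integral sign at `θ₀`
    (hswap : ∫ z, iteratedDerivWithin 2 (fun θ => f z θ) Θ θ₀ ∂ν = 0)
    (Z : ℕ → Ω → 𝒵) (hZ_meas : ∀ i, Measurable (Z i)) (hZ_indep : iIndepFun Z P)
    (hZ_law : ∀ i, P.map (Z i) = BiasMLE.law ν f θ₀)
    (θhat : ℕ → Ω → ℝ)
    (hMLE : ∀ n ω, BiasMLE.IsMLE f Θ n (fun i => Z i ω) (θhat n ω)) :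
    BiasMLE.IsLittleOp P
      (fun n ω =>
        Real.sqrt n *
            (BiasMLE.biasEst f Θ n (fun i => Z i ω) (θhat n ω) - BiasMLE.bias ν f Θ θ₀)
          - BiasMLE.BB ν f Θ θ₀ n (fun i => Z i ω))
      (fun _ => 1) ∧
    BiasMLE.IsLittleOp P
      (fun n ω =>
        Real.sqrt n *
            (BiasMLE.correctedMLE f Θ n (fun i => Z i ω) (θhat n ω) - θ₀)
          - (BiasMLE.A1 ν f Θ θ₀ n (fun i => Z i ω)
            + 1 / Real.sqrt n *
              (BiasMLE.A2 ν f Θ θ₀ n (fun i => Z i ω) - BiasMLE.bias ν f Θ θ₀)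
            + 1 / (n : ℝ) *
              (BiasMLE.A3 ν f Θ θ₀ n (fun i => Z i ω)
                - BiasMLE.BB ν f Θ θ₀ n (fun i => Z i ω))))
      (fun n => (n : ℝ)⁻¹) := by
  have hZ : BiasMLE.IsIIDSample P (BiasMLE.law ν f θ₀) Z := ⟨hZ_meas, hZ_indep, hZ_law⟩
  obtain ⟨-, S, hS, hbias⟩ := hreg.hasExpansion_biasEst hinfo hswap hZ hMLE
  obtain ⟨R, hR, hmle⟩ := hreg.mle_expansion hinfo hZ hMLE
  constructor
  · rw [BiasMLE.isLittleOp_iff]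
    refine hS.tendsto_rate_mul.congr' ?_
    filter_upwards [hbias, BiasMLE.eventually_pos_whp] with p hp hn
    rw [hp, div_one]
    linear_combination (-(BiasMLE.BB ν f Θ θ₀ p.1 fun i => Z i p.2) - BiasMLE.rate p * S p)
      * BiasMLE.rate_mul_sqrt hn
  · rw [BiasMLE.isLittleOp_iff]
    -- the errors of the estimator and of the bias estimate both contribute at order `n^{-3/2}`
    refine (hR.sub hS).tendsto_rate_mul.congr' ?_
    filter_upwards [hbias, hmle, BiasMLE.eventually_pos_whp] with p hp hp' hn
    have h1 : (p.1 : ℝ)⁻¹ = BiasMLE.rate p ^ 2 :=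
      (eq_inv_of_mul_eq_one_left (BiasMLE.rate_sq_mul_natCast hn)).symm
    have hrate : BiasMLE.rate p ≠ 0 := (inv_pos.2 (BiasMLE.sqrt_natCast_pos hn)).ne'
    have h2 : 1 / √(p.1 : ℝ) = BiasMLE.rate p := one_div _
    rw [BiasMLE.correctedMLE, div_eq_mul_inv (BiasMLE.biasEst _ _ _ _ _), hp, one_div (p.1 : ℝ),
      h1, h2, eq_div_iff (pow_ne_zero 2 hrate)]
    set b := BiasMLE.bias ν f Θ θ₀
    set B := BiasMLE.BB ν f Θ θ₀ p.1 fun i => Z i p.2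
    linear_combination -hp' + BiasMLE.rate p * (b + BiasMLE.rate p * B + BiasMLE.rate p ^ 2 * S p)
      * BiasMLE.rate_mul_sqrt hn
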